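/- All normed spaces are real. A \emph{Gurarij space} is a Banach space $G$ such that for every $\varepsilon>0$, all finite-dimensional normed spaces $A\subseteq B$ and every linear isometric embedding $\varphi\colon A\to G$ there is a linear map $\psi\colon B\to G$ extending $\varphi$ with $(1-\varepsilon)\|x\|\le\|\psi x\|\le(1+\varepsilon)\|x\|$ for all $x\in B$. Let $\mathbb G$ be the separable Gurarij space (which is unique up to linear isometry). For a Banach space $E$ and $n\in\mathbb N$, an \emph{$n$-type over $E$} is a seminorm $\xi=\|\cdot\|^\xi$ on $E(n)=E\oplus\bigoplus_{i<n}\mathbb R x_i$ extending the norm of $E$. The set $S_n(E)$ of $n$-types carries the coarsest topology for which $\xi\mapsto\|x\|^\xi$ is continuous for every $x\in E(n)$. If $E\subseteq F$ is an isometric inclusion of Banach spaces and $\bar a\in F^n$, then $\bar a$ \emph{realises} the type $\mathrm{tp}(\bar a/E)\in S_n(E)$ given by $\|b+\sum_i\lambda_i x_i\|^{\mathrm{tp}(\bar a/E)}=\|b+\sum_i\lambda_i a_i\|$. The distance $d(\xi,\zeta)$ is the infimum of $\sup_i\|a_i-b_i\|$ over all Banach spaces $F\supseteq E$ and all realisations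 $\bar a,\bar b\in F^n$ of $\xi$ and $\zeta$ respectively. A type $\xi\in S_n(E)$ is \emph{isolated} if for every $r>0$ the ball $\{\zeta : d(\xi,\zeta)<r\}$ is a neighbourhood of $\xi$ in the topology of $S_n(E)$. A Banach space $F\supseteq E$ is \emph{atomic over $E$} if for every $n$ and every $\bar a\in F^n$ the type $\mathrm{tp}(\bar a/E)$ is isolated. For separable $E$, we say that $\mathbb G[E]$ exists if there is a separable Gurarij space containing $E$ isometrically and atomic over $E$. Let $E$ be a separable Banach space, let $H=\mathrm{Aut}(\mathbb G)$ be the group of linear isometric automorphisms of $\mathbb G$, and let $H$ act by composition on the space $X=\mathrm{Emb}(E,\mathbb G)$ of linear isometric embeddings, where both $H$ and $X$ are equipped with the topology of pointwise convergence (the strong operator topology). Call $\varphi\in X$ \emph{atomic} if $\mathbb G$ is atomic over $\varphi E$. \begin{enumerate} \item The space $X$ is Polish, the action of $H$ on $X$ is continuous (jointly, as a map $H\times X\to X$), and all its orbits are dense. \item If $\mathbb G[E]$ exists, then the set of atomic embeddings is a dense $G_\delta$ subset of $X$ and is a single orbit of the action. \item If $\mathbb G[E]$ does not exist, then there are no atomic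 embeddings, and every orbit is meagre in $X$. \end{enumerate} -/

import Mathlib

open Topology
open scoped ENNReal

universe u v

/-- A (quantifier-free) `n`-type over `E`: a seminorm on `E(n) = E ⊕ ℝx₀ ⊕ ⋯ ⊕ ℝxₙ₋₁` which extends
the norm of `E`.  The element `b + ∑ i, c i • xᵢ` of `E(n)` is the pair `(b, c)`. -/
structure BanachType (E : Type u) [NormedAddCommGroup E] [NormedSpace ℝ E] (n : ℕ) where
  toSeminorm : Seminorm ℝ (E × (Fin n → ℝ))
  extends_norm : ∀ b : E, toSeminorm (b, 0) = ‖b‖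

namespace BanachType

variable {E : Type u} [NormedAddCommGroup E] [NormedSpace ℝ E] {n : ℕ}

/-- The topology on the space of `n`-types: the coarsest one for which `ξ ↦ ‖x‖^ξ` is continuous for
every `x ∈ E(n)`. -/
instance : TopologicalSpace (BanachType E n) :=
  ⨅ x : E × (Fin n → ℝ),
    TopologicalSpace.induced (fun ξ : BanachType E n => ξ.toSeminorm x) inferInstance

/-- The tuple `a` of an extension `i : E → F` realises `ξ`, that is, `ξ = tp(a/E)`. -/
def IsRealisedBy {F : Type v} [NormedAddCommGroup F] [NormedSpace ℝ F]
    (ξ : BanachType E n) (i : E →ₗᵢ[ℝ] F) (a : Fin n → F) : Prop :=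
  ∀ (b : E) (c : Fin n → ℝ), ξ.toSeminorm (b, c) = ‖i b + ∑ k, c k • a k‖

/-- The distance between two types: the infimum of `sup_k ‖a_k - b_k‖` over all Banach space
extensions `F` of `E` and all realisations `a` and `b` in `F` of the two types. -/
noncomputable def tdist (ξ ζ : BanachType E n) : ℝ≥0∞ :=
  sInf {r : ℝ≥0∞ | ∃ (F : Type u) (_ : NormedAddCommGroup F) (_ : NormedSpace ℝ F)
    (_ : CompleteSpace F) (i : E →ₗᵢ[ℝ] F) (a b : Fin n → F),
      ξ.IsRealisedBy i a ∧ ζ.IsRealisedBy i b ∧ r = ⨆ k, ENNReal.ofReal ‖a k - b k‖}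

/-- A type is isolated if each of its metric neighbourhoods is a topological neighbourhood. -/
def IsIsolated (ξ : BanachType E n) : Prop :=
  ∀ r : ℝ≥0∞, 0 < r → {ζ : BanachType E n | tdist ξ ζ < r} ∈ 𝓝 ξ

end BanachType

section Embeddings

variable {E : Type u} [NormedAddCommGroup E] [NormedSpace ℝ E]
  {F : Type v} [NormedAddCommGroup F] [NormedSpace ℝ F]

/-- The type over `E` of a tuple `a` in the extension `i : E → F`:
`‖b + ∑ c_k x_k‖ = ‖i b + ∑ c_k a_k‖`. -/
noncomputable def typeOf (i : E →ₗᵢ[ℝ] F) {n : ℕ} (a : Fin n → F) : BanachType E n where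
  toSeminorm := (normSeminorm ℝ F).comp
    (i.toLinearMap.coprod (Fintype.linearCombination ℝ a))
  extends_norm := fun b => by simp

theorem typeOf_isRealisedBy (i : E →ₗᵢ[ℝ] F) {n : ℕ} (a : Fin n → F) :
    (typeOf i a).IsRealisedBy i a := by
  intro b c
  simp [typeOf, Fintype.linearCombination_apply]

/-- The extension `i : E → F` is atomic: `F` is atomic over (the copy `i E` of) `E`, i.e. the type
over `E` of every finite tuple in `F` is isolated. -/
def IsAtomicOver (i : E →ₗᵢ[ℝ] F) : Prop :=
  ∀ (n : ℕ) (a : Fin n → F), (typeOf i a).IsIsolated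

/-- The topology of pointwise convergence on the isometric embeddings `Emb(E, F)`. -/
instance : TopologicalSpace (E →ₗᵢ[ℝ] F) :=
  TopologicalSpace.induced (fun (φ : E →ₗᵢ[ℝ] F) (x : E) => φ x) inferInstance

/-- The topology of pointwise convergence on the linear isometry group `Aut(F)`. -/
instance : TopologicalSpace (F ≃ₗᵢ[ℝ] F) :=
  TopologicalSpace.induced (fun (h : F ≃ₗᵢ[ℝ] F) (x : F) => h x) inferInstance

/-- The action of `Aut(F)` on `Emb(E, F)` by composition. -/
instance : MulAction (F ≃ₗᵢ[ℝ] F) (E →ₗᵢ[ℝ] F) where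
  smul h φ := h.toLinearIsometry.comp φ
  one_smul _ := rfl
  mul_smul _ _ _ := rfl

end Embeddings

/-- Gurarij spaces: Banach spaces `G` such that for all finite-dimensional `A ⊆ B`, every isometric
embedding of `A` in `G` extends to a linear map on `B` which is isometric up to a factor `1 ± ε`.
As `B` ranges over finite-dimensional spaces, `Type` contains an isometric copy of each. -/
structure IsGurarij (G : Type v) [NormedAddCommGroup G] [NormedSpace ℝ G] : Prop where
  complete : CompleteSpace G
  exists_extension : ∀ ε : ℝ, 0 < ε →
    ∀ (B : Type) [NormedAddCommGroup B] [NormedSpace ℝ B] [FiniteDimensional ℝ B]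
      (A : Submodule ℝ B) (φ : A →ₗᵢ[ℝ] G),
      ∃ ψ : B →ₗ[ℝ] G, (∀ x : A, ψ x = φ x) ∧
        ∀ x : B, (1 - ε) * ‖x‖ ≤ ‖ψ x‖ ∧ ‖ψ x‖ ≤ (1 + ε) * ‖x‖

/-- `𝔾[E]` exists: there is a separable Gurarij space containing `E` and atomic over `E`. -/
def ExistsAtomicGurarij (E : Type u) [NormedAddCommGroup E] [NormedSpace ℝ E] : Prop :=
  ∃ (F : Type u) (_ : NormedAddCommGroup F) (_ : NormedSpace ℝ F) (i : E →ₗᵢ[ℝ] F),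
    TopologicalSpace.SeparableSpace F ∧ IsGurarij F ∧ IsAtomicOver i

-- The metric on types has an intrinsic form: apart from the boundary case, being at distance below
-- s means that the two seminorms differ by at most s ∑ |c_k|, uniformly in b (`tdist_le_of_close`,
-- `close_of_tdist_lt`). An isolated type is thus one near which pointwise and uniform closeness
-- agree.
--
-- Amalgams of F and G over E, viewed as seminorms on F × G, form a compact space, hence a Baire
-- space. If F is atomic over E and G is Gurarij, the amalgams that put a given vector of F within δ
-- of G form a dense open set: the Gurarij property imitates a tuple of F by one of G whose type is
-- pointwise close, isolation makes it uniformly close, and the two are re-amalgamated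
-- (`IsAmalgam.exists_extension`). For separable F a generic amalgam is then an embedding of F in G
-- over E, and when both sides are atomic, separable and Gurarij it is an isomorphism. This replaces
-- a back-and-forth construction.
--
-- Over the trivial space every type is isolated, by compactness of the unit sphere. There the
-- argument gives uniqueness of the Gurarij space and density of all orbits; over E it makes the
-- atomic embeddings into it a single orbit.
--
-- Atomicity is G_δ because it can be tested on a dense sequence of tuples. If an embedding is not
-- atomic, its whole orbit realises one fixed non-isolated type, and such a type is omitted by
-- generic embeddings (`IsGurarij.isMeagre_setOf_realises`).

universe w

/-! ### Amalgamation of seminorms -/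

section Amalgamation

variable {U V W : Type*} [AddCommGroup U] [Module ℝ U] [AddCommGroup V] [Module ℝ V]
  [AddCommGroup W] [Module ℝ W]

/-- Approximate amalgamation: if `p ∘ f` and `q ∘ g` differ by at most the seminorm `ρ` on `U`, then
there is a seminorm on `V × W` which extends `p` and `q` and for which `f u` and `g u` are at
distance at most `ρ u`. -/
theorem Seminorm.exists_amalgam (p : Seminorm ℝ V) (q : Seminorm ℝ W) (ρ : Seminorm ℝ U)
    (f : U →ₗ[ℝ] V) (g : U →ₗ[ℝ] W) (h : ∀ u, |p (f u) - q (g u)| ≤ ρ u) :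
    ∃ N : Seminorm ℝ (V × W), (∀ v, N (v, 0) = p v) ∧ (∀ w, N (0, w) = q w) ∧
      ∀ u, N (f u, -g u) ≤ ρ u := by
  -- Infimal convolution: a vector u is transferred from one side to the other at cost `ρ u`. The
  -- hypothesis `h` says that no transfer makes an element of V or W cheaper than its own seminorm.
  let F : V × W → U → ℝ := fun x u => p (x.1 - f u) + q (x.2 + g u) + ρ u
  have F0 : ∀ x u, 0 ≤ F x u := fun x u => by positivity
  have hbdd : ∀ x, BddBelow (Set.range (F x)) :=
    fun x => ⟨0, by rintro _ ⟨u, rfl⟩; exact F0 x u⟩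
  let N : Seminorm ℝ (V × W) := Seminorm.ofSMulLE (fun x => ⨅ u, F x u)
    (le_antisymm ((ciInf_le (hbdd 0) 0).trans (by simp [F])) (le_ciInf fun u => F0 0 u))
    (fun x y => by
      refine le_ciInf_add_ciInf fun u u' => (ciInf_le (hbdd _) (u + u')).trans ?_
      have h1 : p ((x + y).1 - f (u + u')) ≤ p (x.1 - f u) + p (y.1 - f u') := by
        refine le_of_eq_of_le (congrArg p ?_) (map_add_le_add p _ _)
        simp only [map_add, Prod.fst_add]; abel
      have h2 : q ((x + y).2 + g (u + u')) ≤ q (x.2 + g u) + q (y.2 + g u') := by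
        refine le_of_eq_of_le (congrArg q ?_) (map_add_le_add q _ _)
        simp only [map_add, Prod.snd_add]; abel
      have h3 := map_add_le_add ρ u u'
      simp only [F]; linarith)
    (fun r x => by
      rw [Real.mul_iInf_of_nonneg (norm_nonneg r)]
      refine le_ciInf fun u => (ciInf_le (hbdd _) (r • u)).trans (le_of_eq ?_)
      simp only [F, map_smul, Prod.smul_fst, Prod.smul_snd, ← smul_sub, ← smul_add, map_smul_eq_mul]
      ring)
  have hN : ∀ x, N x = ⨅ u, F x u := fun x => rfl
  refine ⟨N, fun v => ?_, fun w => ?_, fun u => ?_⟩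
  · rw [hN]
    refine le_antisymm ((ciInf_le (hbdd _) 0).trans (by simp [F])) (le_ciInf fun u => ?_)
    have h1 : p v ≤ p (v - f u) + p (f u) := by simpa using map_add_le_add p (v - f u) (f u)
    have h2 := (abs_le.1 (h u)).2
    simp only [F, zero_add]; linarith
  · rw [hN]
    refine le_antisymm ((ciInf_le (hbdd _) 0).trans (by simp [F])) (le_ciInf fun u => ?_)
    have h1 : q w ≤ q (w + g u) + q (g u) := by simpa using map_sub_le_add q (w + g u) (g u)
    have h2 := (abs_le.1 (h u)).1
    simp only [F, zero_sub, map_neg_eq_map]; linarith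
  · rw [hN]
    exact (ciInf_le (hbdd _) u).trans (by simp [F])

end Amalgamation

/-- Every seminorm is pulled back from a norm along a surjective linear map. -/
theorem Seminorm.exists_normed_quotient {V : Type u} [AddCommGroup V] [Module ℝ V]
    (p : Seminorm ℝ V) :
    ∃ (F : Type u) (_ : NormedAddCommGroup F) (_ : NormedSpace ℝ F) (π : V →ₗ[ℝ] F),
      Function.Surjective π ∧ ∀ v, ‖π v‖ = p v := by
  let : SeminormedAddCommGroup V := p.toAddGroupSeminorm.toSeminormedAddCommGroup
  let : NormedSpace ℝ V := { norm_smul_le := fun r x => (map_smul_eq_mul p r x).le }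
  exact ⟨SeparationQuotient V, inferInstance, inferInstance,
    (SeparationQuotient.mkCLM ℝ V).toLinearMap, SeparationQuotient.surjective_mk, fun v => rfl⟩

/-- Every seminorm is pulled back from the norm of a Banach space along a linear map. -/
theorem Seminorm.exists_banach_map {V : Type u} [AddCommGroup V] [Module ℝ V]
    (p : Seminorm ℝ V) :
    ∃ (F : Type u) (_ : NormedAddCommGroup F) (_ : NormedSpace ℝ F) (_ : CompleteSpace F)
      (π : V →ₗ[ℝ] F), ∀ v, ‖π v‖ = p v := by
  obtain ⟨F, _, _, π, -, hπ⟩ := p.exists_normed_quotient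
  refine ⟨UniformSpace.Completion F, inferInstance, inferInstance, inferInstance,
    UniformSpace.Completion.toComplₗᵢ.toLinearMap ∘ₗ π, fun v => ?_⟩
  simp [hπ]

section Coefficients

variable {F : Type*} [SeminormedAddCommGroup F] [NormedSpace ℝ F] {n : ℕ}

/-- The `ℓ¹`-seminorm of the coefficients, scaled by `s`. -/
noncomputable def coeffSeminorm (V : Type*) [AddCommGroup V] [Module ℝ V] (n : ℕ) (s : ℝ)
    (hs : 0 ≤ s) : Seminorm ℝ (V × (Fin n → ℝ)) :=
  Seminorm.ofSMulLE (fun x => s * ∑ k, |x.2 k|) (by simp)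
    (fun x y => by
      rw [← mul_add, ← Finset.sum_add_distrib]
      gcongr with k
      exact abs_add_le _ _)
    (fun r x => by
      simp only [Prod.smul_snd, Pi.smul_apply, smul_eq_mul, abs_mul, ← Finset.mul_sum,
        Real.norm_eq_abs]
      exact le_of_eq (by ring))

@[simp] theorem coeffSeminorm_apply (V : Type*) [AddCommGroup V] [Module ℝ V] (s : ℝ)
    (hs : 0 ≤ s) (x : V × (Fin n → ℝ)) : coeffSeminorm V n s hs x = s * ∑ k, |x.2 k| := rfl

theorem norm_sum_smul_le {s : ℝ} {a : Fin n → F} (h : ∀ k, ‖a k‖ ≤ s)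
    (c : Fin n → ℝ) : ‖∑ k, c k • a k‖ ≤ s * ∑ k, |c k| := by
  rw [Finset.mul_sum]
  refine norm_sum_le_of_le _ fun k _ => ?_
  rw [norm_smul, Real.norm_eq_abs, mul_comm]
  exact mul_le_mul_of_nonneg_right (h k) (abs_nonneg _)

theorem Seminorm.sum_smul_le {V : Type*} [AddCommGroup V] [Module ℝ V] (p : Seminorm ℝ V) {s : ℝ}
    {a : Fin n → V} (h : ∀ k, p (a k) ≤ s) (c : Fin n → ℝ) :
    p (∑ k, c k • a k) ≤ s * ∑ k, |c k| := by
  obtain ⟨F, _, _, π, -, hπ⟩ := p.exists_normed_quotient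
  have := norm_sum_smul_le (a := fun k => π (a k)) (s := s) (fun k => (hπ _).trans_le (h k)) c
  rw [← hπ]
  simpa using this

end Coefficients

/-! ### The metric on types as uniform closeness of seminorms -/

namespace BanachType

variable {E : Type u} [NormedAddCommGroup E] [NormedSpace ℝ E] {n : ℕ}

/-- Two types are `s`-close if they differ by at most `s` times the `ℓ¹`-norm of the
coefficients. -/
def Close (s : ℝ) (ξ ζ : BanachType E n) : Prop :=
  ∀ (b : E) (c : Fin n → ℝ), |ξ.toSeminorm (b, c) - ζ.toSeminorm (b, c)| ≤ s * ∑ k, |c k|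

theorem Close.symm {s : ℝ} {ξ ζ : BanachType E n} (h : Close s ξ ζ) : Close s ζ ξ :=
  fun b c => by rw [abs_sub_comm]; exact h b c

theorem Close.trans {s t : ℝ} {ξ ζ χ : BanachType E n} (h : Close s ξ ζ) (h' : Close t ζ χ) :
    Close (s + t) ξ χ := fun b c => by
  rw [add_mul]
  exact (abs_sub_le _ _ _).trans (add_le_add (h b c) (h' b c))

theorem Close.mono {s t : ℝ} {ξ ζ : BanachType E n} (h : Close s ξ ζ) (hst : s ≤ t) :
    Close t ξ ζ := fun b c =>
  (h b c).trans (mul_le_mul_of_nonneg_right hst (Finset.sum_nonneg fun _ _ => abs_nonneg _))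

@[ext] theorem ext {ξ ζ : BanachType E n} (h : ∀ x, ξ.toSeminorm x = ζ.toSeminorm x) : ξ = ζ := by
  cases ξ; cases ζ
  congr
  exact Seminorm.ext h

/-- Two copies of E(n) are amalgamated with transfer cost s times the ℓ¹-norm of the coefficients.
This cost vanishes on E, so the copies of E are glued, while corresponding generators end up within
s. -/
theorem tdist_le_of_close {s : ℝ} (hs : 0 ≤ s) {ξ ζ : BanachType E n} (h : Close s ξ ζ) :
    tdist ξ ζ ≤ ENNReal.ofReal s := by
  obtain ⟨N, h1, h2, h3⟩ := Seminorm.exists_amalgam ξ.toSeminorm ζ.toSeminorm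
    (coeffSeminorm E n s hs) LinearMap.id LinearMap.id (fun x => h x.1 x.2)
  obtain ⟨F, _, _, _, π, hπ⟩ := N.exists_banach_map
  have hzero : ∀ b : E, π ((b, 0), 0) = π (0, (b, 0)) := fun b => by
    rw [← sub_eq_zero, ← map_sub, ← norm_eq_zero, hπ]
    refine le_antisymm ?_ (apply_nonneg _ _)
    simpa using h3 (b, 0)
  have hvec : ∀ (x : E × (Fin n → ℝ)),
      x = (x.1, 0) + ∑ k, x.2 k • ((0 : E), (Pi.single k 1 : Fin n → ℝ)) := by
    rintro ⟨b, c⟩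
    ext
    · simp [Prod.fst_sum]
    · simp [Prod.snd_sum, Finset.sum_apply, Pi.single_apply]
  let ι₁ : (E × (Fin n → ℝ)) →ₗ[ℝ] F := π ∘ₗ LinearMap.inl ℝ _ _
  let ι₂ : (E × (Fin n → ℝ)) →ₗ[ℝ] F := π ∘ₗ LinearMap.inr ℝ _ _
  let i : E →ₗᵢ[ℝ] F := ⟨ι₁ ∘ₗ LinearMap.inl ℝ _ _, fun b => by simp [ι₁, hπ, h1, ξ.extends_norm]⟩
  have ha : ξ.IsRealisedBy i fun k => ι₁ (0, Pi.single k 1) := fun b c => by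
    change _ = ‖ι₁ (b, 0) + ∑ k, c k • ι₁ (0, Pi.single k 1)‖
    have := congrArg ι₁ (hvec (b, c))
    simp only [map_add, map_sum, map_smul] at this
    rw [← this]
    simp [ι₁, hπ, h1]
  have hb : ζ.IsRealisedBy i fun k => ι₂ (0, Pi.single k 1) := fun b c => by
    change _ = ‖ι₁ (b, 0) + ∑ k, c k • ι₂ (0, Pi.single k 1)‖
    have h4 : ι₁ (b, 0) = ι₂ (b, 0) := by simpa [ι₁, ι₂] using hzero b
    have := congrArg ι₂ (hvec (b, c))
    simp only [map_add, map_sum, map_smul] at this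
    rw [h4, ← this]
    simp [ι₂, hπ, h2]
  unfold tdist
  refine sInf_le_of_le ⟨F, _, _, ‹_›, i, _, _, ha, hb, rfl⟩
    (iSup_le fun k => ENNReal.ofReal_le_ofReal ?_)
  have := h3 (0, Pi.single k 1)
  simp only [ι₁, ι₂, LinearMap.comp_apply, ← map_sub, hπ, LinearMap.inl_apply,
    LinearMap.inr_apply]
  simpa [Pi.single_apply, apply_ite abs] using this

theorem IsRealisedBy.close {F : Type v} [NormedAddCommGroup F] [NormedSpace ℝ F]
    {ξ ζ : BanachType E n} {i : E →ₗᵢ[ℝ] F} {a b : Fin n → F} (ha : ξ.IsRealisedBy i a)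
    (hb : ζ.IsRealisedBy i b) {s : ℝ} (h : ∀ k, ‖a k - b k‖ ≤ s) : Close s ξ ζ := fun e c => by
  rw [ha, hb]
  refine (abs_norm_sub_norm_le _ _).trans (le_of_eq_of_le (congrArg norm ?_) (norm_sum_smul_le h c))
  simp [smul_sub]

theorem close_of_tdist_lt {s : ℝ} {ξ ζ : BanachType E n} (h : tdist ξ ζ < ENNReal.ofReal s) :
    Close s ξ ζ := by
  obtain ⟨r, ⟨F, _, _, _, i, a, b, ha, hb, rfl⟩, hr⟩ := sInf_lt_iff.1 h
  have hs : 0 < s := by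
    by_contra hs
    rw [ENNReal.ofReal_of_nonpos (not_lt.1 hs)] at h
    exact not_lt_bot h
  exact ha.close hb fun k => (ENNReal.ofReal_le_ofReal_iff hs.le).1 ((le_iSup _ k).trans hr.le)

/-- A type is isolated if and only if all its uniform neighbourhoods are neighbourhoods. -/
theorem isIsolated_iff {ξ : BanachType E n} :
    ξ.IsIsolated ↔ ∀ s : ℝ, 0 < s → {ζ | Close s ξ ζ} ∈ 𝓝 ξ := by
  refine ⟨fun h s hs => Filter.mem_of_superset (h (ENNReal.ofReal s) (by simpa))
    fun ζ => close_of_tdist_lt, fun h r hr => ?_⟩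
  obtain ⟨s, hs, hsr⟩ : ∃ s : ℝ, 0 < s ∧ ENNReal.ofReal s < r := by
    obtain ⟨t, ht, htr⟩ := ENNReal.lt_iff_exists_nnreal_btwn.1 hr
    exact ⟨t, by exact_mod_cast ht, by simpa using htr⟩
  exact Filter.mem_of_superset (h s hs) fun ζ hζ => (tdist_le_of_close hs.le hζ).trans_lt hsr

end BanachType

/-! ### Neighbourhoods in topologies of pointwise convergence -/

theorem mem_nhds_pi_iff_exists_finset {ι M : Type*} [PseudoMetricSpace M] {x : ι → M}
    {s : Set (ι → M)} :
    s ∈ 𝓝 x ↔ ∃ T : Finset ι, ∃ ε > 0, ∀ y : ι → M, (∀ i ∈ T, dist (y i) (x i) < ε) → y ∈ s := by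
  rw [nhds_pi, Filter.mem_pi']
  constructor
  · rintro ⟨T, t, ht, hts⟩
    have : ∀ᶠ ε in 𝓝[>] (0 : ℝ), ∀ i ∈ T, Metric.ball (x i) ε ⊆ t i := by
      refine (Filter.eventually_all_finset T).2 fun i _ => ?_
      obtain ⟨r, hr, hrt⟩ := Metric.mem_nhds_iff.1 (ht i)
      filter_upwards [Ioo_mem_nhdsGT hr] with ε hε
      exact (Metric.ball_subset_ball hε.2.le).trans hrt
    obtain ⟨ε, hεT, hε⟩ := (this.and self_mem_nhdsWithin).exists
    exact ⟨T, ε, hε, fun y hy => hts fun i hi => hεT i hi (hy i hi)⟩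
  · rintro ⟨T, ε, hε, h⟩
    exact ⟨T, fun i => Metric.ball (x i) ε, fun i => Metric.ball_mem_nhds _ hε,
      fun y hy => h y fun i hi => hy i hi⟩

theorem Topology.IsInducing.mem_nhds_iff_exists_finset {X ι M : Type*} [TopologicalSpace X]
    [PseudoMetricSpace M] {f : X → ι → M} (hf : IsInducing f) {x : X} {s : Set X} :
    s ∈ 𝓝 x ↔ ∃ T : Finset ι, ∃ ε > 0, ∀ y, (∀ i ∈ T, dist (f y i) (f x i) < ε) → y ∈ s := by
  rw [hf.nhds_eq_comap, Filter.mem_comap]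
  constructor
  · rintro ⟨t, ht, hts⟩
    obtain ⟨T, ε, hε, h⟩ := mem_nhds_pi_iff_exists_finset.1 ht
    exact ⟨T, ε, hε, fun y hy => hts (h _ hy)⟩
  · rintro ⟨T, ε, hε, h⟩
    exact ⟨{z | ∀ i ∈ T, dist (z i) (f x i) < ε},
      mem_nhds_pi_iff_exists_finset.2 ⟨T, ε, hε, fun y hy => hy⟩, fun y hy => h y hy⟩

/-- Finitely many nonnegative numbers are made small by a common positive factor. -/
theorem exists_pos_forall_mul_lt {ι : Type*} (T : Finset ι) (f : ι → ℝ) {δ : ℝ} (hδ : 0 < δ) :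
    ∃ η > 0, ∀ i ∈ T, η * f i < δ := by
  have : ∀ᶠ η in 𝓝[>] (0 : ℝ), ∀ i ∈ T, η * f i < δ := by
    refine (Filter.eventually_all_finset T).2 fun i _ => ?_
    have : Filter.Tendsto (fun η => η * f i) (𝓝 (0 : ℝ)) (𝓝 (0 * f i)) :=
      (continuous_id.mul continuous_const).tendsto 0
    rw [zero_mul] at this
    exact (this.mono_left nhdsWithin_le_nhds).eventually_lt_const hδ
  obtain ⟨η, h1, h2⟩ := (this.and self_mem_nhdsWithin).exists
  exact ⟨η, h2, h1⟩

/-! ### Types over the trivial space, and tuples in Gurarij spaces -/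

namespace BanachType

variable {E : Type u} [NormedAddCommGroup E] [NormedSpace ℝ E] {n : ℕ}

theorem isInducing_toSeminorm :
    IsInducing fun (ξ : BanachType E n) (x : E × (Fin n → ℝ)) => ξ.toSeminorm x :=
  ⟨(induced_to_pi _).symm⟩

theorem continuous_toSeminorm (x : E × (Fin n → ℝ)) :
    Continuous fun ξ : BanachType E n => ξ.toSeminorm x :=
  (continuous_apply x).comp isInducing_toSeminorm.continuous

theorem mem_nhds_iff {ξ : BanachType E n} {s : Set (BanachType E n)} :
    s ∈ 𝓝 ξ ↔ ∃ T : Finset (E × (Fin n → ℝ)), ∃ ε > 0, ∀ ζ : BanachType E n,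
      (∀ x ∈ T, |ζ.toSeminorm x - ξ.toSeminorm x| < ε) → ζ ∈ s := by
  simp only [isInducing_toSeminorm.mem_nhds_iff_exists_finset, Real.dist_eq]

/-- Over the trivial space, every type is isolated. -/
theorem isIsolated_of_subsingleton [Subsingleton E] (ξ : BanachType E n) : ξ.IsIsolated := by
  refine isIsolated_iff.2 fun s hs => ?_
  let x : Fin n → E × (Fin n → ℝ) := fun k => (0, Pi.single k 1)
  have hsum : ∀ c : Fin n → ℝ, ((0 : E), c) = ∑ k, c k • x k := fun c => by
    ext
    · simp [x, Prod.fst_sum]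
    · simp [x, Prod.snd_sum, Finset.sum_apply, Pi.single_apply]
  -- The extra 1 makes the bound on the generators strict, hence open, so it persists for types near
  -- ξ. Then C is a common Lipschitz constant for the ℓ¹-norm.
  let C : ℝ := ∑ k, ξ.toSeminorm (x k) + 1
  have hle : ∀ k, ξ.toSeminorm (x k) < C := fun k =>
    (Finset.single_le_sum (f := fun k => ξ.toSeminorm (x k)) (fun _ _ => apply_nonneg _ _)
      (Finset.mem_univ k)).trans_lt (lt_add_one _)
  have hC : ∀ᶠ ζ in 𝓝 ξ, ∀ k, ζ.toSeminorm (x k) < C :=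
    Filter.eventually_all.2 fun k =>
      (continuous_toSeminorm (x k)).continuousAt.eventually_lt_const (hle k)
  have hbd : ∀ ζ : BanachType E n, (∀ k, ζ.toSeminorm (x k) < C) → ∀ c : Fin n → ℝ,
      ζ.toSeminorm (0, c) ≤ C * ∑ k, |c k| := fun ζ hζ c => by
    rw [hsum]
    exact ζ.toSeminorm.sum_smul_le (fun k => (hζ k).le) c
  let K : Set (Fin n → ℝ) := {c | ∑ k, |c k| = 1}
  have hK : IsCompact K := by
    refine Metric.isCompact_of_isClosed_isBounded (isClosed_eq (by fun_prop) continuous_const)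
      ((Metric.isBounded_closedBall (x := (0 : Fin n → ℝ)) (r := 1)).subset fun c hc => ?_)
    rw [mem_closedBall_zero_iff, pi_norm_le_iff_of_nonneg zero_le_one]
    intro k
    rw [← show ∑ k, |c k| = 1 from hc]
    exact Finset.single_le_sum (f := fun k => |c k|) (fun _ _ => abs_nonneg _) (Finset.mem_univ k)
  -- Compactness of the ℓ¹-sphere turns pointwise into uniform closeness. Moving from c to a nearby
  -- vector costs C times their ℓ¹-distance for each of the two seminorms, whence the factor 2.
  -- Homogeneity later extends the bound off the sphere.
  have hKs : ∀ᶠ ζ in 𝓝 ξ, ∀ c ∈ K, |ξ.toSeminorm (0, c) - ζ.toSeminorm (0, c)| < s := by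
    refine hK.eventually_forall_of_forall_eventually fun c _ => ?_
    have h1 : ∀ᶠ z : BanachType E n × (Fin n → ℝ) in 𝓝 ξ ×ˢ 𝓝 c,
        |ξ.toSeminorm (0, c) - z.1.toSeminorm (0, c)|
          + 2 * (C * ∑ k, |z.2 k - c k|) < s := by
      rw [← nhds_prod_eq]
      have hcont : Continuous fun z : BanachType E n × (Fin n → ℝ) =>
          |ξ.toSeminorm (0, c) - z.1.toSeminorm (0, c)| + 2 * (C * ∑ k, |z.2 k - c k|) := by
        have := (continuous_toSeminorm ((0 : E), c)).comp
          (continuous_fst (X := BanachType E n) (Y := Fin n → ℝ))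
        have h2 : Continuous fun z : BanachType E n × (Fin n → ℝ) => z.1.toSeminorm (0, c) := this
        fun_prop
      exact hcont.continuousAt.eventually_lt_const (by simpa using hs)
    rw [nhds_prod_eq]
    filter_upwards [h1, hC.prod_inl _] with z hz hzC
    have h2 := hbd _ hle (z.2 - c)
    have h3 := hbd _ hzC (z.2 - c)
    have h4 : ∀ ζ : BanachType E n,
        |ζ.toSeminorm (0, z.2) - ζ.toSeminorm (0, c)| ≤ ζ.toSeminorm (0, z.2 - c) := fun ζ => by
      simpa using abs_sub_map_le_sub ζ.toSeminorm (0, z.2) (0, c)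
    have h5 := abs_le.1 (h4 ξ)
    have h6 := abs_le.1 (h4 z.1)
    have h7 := abs_le.1 (le_refl |ξ.toSeminorm (0, c) - z.1.toSeminorm (0, c)|)
    simp only [Pi.sub_apply] at h2 h3
    rw [abs_lt]
    constructor <;> linarith
  filter_upwards [hKs] with ζ hζ b c
  rw [Subsingleton.elim b 0]
  rcases (Finset.sum_nonneg fun k _ => abs_nonneg (c k) : 0 ≤ ∑ k, |c k|).eq_or_lt with h0 | h0
  · have hc : c = 0 := funext fun k => abs_eq_zero.1 <|
      (Finset.sum_eq_zero_iff_of_nonneg fun k _ => abs_nonneg (c k)).1 h0.symm k (Finset.mem_univ k)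
    have h8 : ∀ ζ : BanachType E n, ζ.toSeminorm (0, 0) = 0 := fun ζ => map_zero ζ.toSeminorm
    simp [hc, h8]
  · set r := ∑ k, |c k|
    have h9 : ∀ ζ : BanachType E n, ζ.toSeminorm (0, c) = r * ζ.toSeminorm (0, r⁻¹ • c) := by
      intro ζ
      have := map_smul_eq_mul ζ.toSeminorm r ((0 : E), r⁻¹ • c)
      rw [Prod.smul_mk, smul_zero, smul_inv_smul₀ h0.ne', Real.norm_of_nonneg h0.le] at this
      exact this
    rw [h9, h9, ← mul_sub, abs_mul, abs_of_pos h0, mul_comm]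
    refine mul_le_mul_of_nonneg_right (hζ _ ?_).le h0.le
    change ∑ k, |(r⁻¹ • c) k| = 1
    simp only [Pi.smul_apply, smul_eq_mul, abs_mul, abs_inv, abs_of_pos h0, ← Finset.mul_sum]
    exact inv_mul_cancel₀ h0.ne'

end BanachType

theorem IsAtomicOver.of_subsingleton {E : Type u} [NormedAddCommGroup E] [NormedSpace ℝ E]
    [Subsingleton E] {F : Type v} [NormedAddCommGroup F] [NormedSpace ℝ F] (i : E →ₗᵢ[ℝ] F) :
    IsAtomicOver i :=
  fun _ _ => BanachType.isIsolated_of_subsingleton _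

@[simp] theorem typeOf_apply {E : Type u} [NormedAddCommGroup E] [NormedSpace ℝ E]
    {F : Type v} [NormedAddCommGroup F] [NormedSpace ℝ F] (i : E →ₗᵢ[ℝ] F) {n : ℕ}
    (a : Fin n → F) (x : E × (Fin n → ℝ)) :
    (typeOf i a).toSeminorm x = ‖i x.1 + ∑ k, x.2 k • a k‖ :=
  typeOf_isRealisedBy i a x.1 x.2

/-- Given an amalgam `N` of `F` with a Gurarij space `G` and a finite-dimensional subspace `W` of
`G`, every tuple in `F` is imitated over `W` by a tuple in `G`. -/
theorem IsGurarij.exists_tuple {G : Type v} [NormedAddCommGroup G] [NormedSpace ℝ G]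
    (hG : IsGurarij G) {F : Type u} [AddCommGroup F] [Module ℝ F] (N : Seminorm ℝ (F × G))
    (hN : ∀ g, N (0, g) = ‖g‖) {n : ℕ} (f : Fin n → F) (W : Submodule ℝ G)
    [FiniteDimensional ℝ W] {η : ℝ} (hη : 0 < η) :
    ∃ c : Fin n → G, ∀ (t : Fin n → ℝ), ∀ w ∈ W,
      |‖∑ k, t k • c k + w‖ - N (∑ k, t k • f k, w)| ≤ η * N (∑ k, t k • f k, w) := by
  -- Working in coordinates keeps the quotient B in `Type`, where the Gurarij property is stated.
  -- The quotient kills the null vectors of N, but the part coming from W survives because N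
  -- restricts to the norm of G.
  let e := (Module.finBasis ℝ W).equivFun.symm
  let T : (Fin n → ℝ) × (Fin (Module.finrank ℝ W) → ℝ) →ₗ[ℝ] F × G :=
    (Fintype.linearCombination ℝ f).prodMap (W.subtype ∘ₗ e.toLinearMap)
  obtain ⟨B, _, _, π, hπ, hnorm⟩ := (N.comp T).exists_normed_quotient
  have : FiniteDimensional ℝ B := Module.Finite.of_surjective π hπ
  let j : (Fin (Module.finrank ℝ W) → ℝ) →ₗ[ℝ] B := π ∘ₗ LinearMap.inr ℝ _ _
  have hj : ∀ x, ‖j x‖ = ‖e x‖ := fun x => by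
    simp [j, hnorm, T, hN]
  have hinj : Function.Injective j := (injective_iff_map_eq_zero j).2 fun x hx => by
    have := hj x
    rw [hx, norm_zero] at this
    exact e.map_eq_zero_iff.1 (norm_eq_zero.1 this.symm)
  let ej := LinearEquiv.ofInjective j hinj
  let φ : LinearMap.range j →ₗᵢ[ℝ] G :=
    ⟨W.subtype ∘ₗ e.toLinearMap ∘ₗ ej.symm.toLinearMap, fun x => by
      obtain ⟨y, rfl⟩ := ej.surjective x
      simpa [ej] using (hj y).symm⟩
  obtain ⟨ψ, hψ, hψn⟩ := hG.exists_extension η hη B _ φ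
  refine ⟨fun k => ψ (π (Pi.single k 1, 0)), fun t w hw => ?_⟩
  obtain ⟨y, hy⟩ := e.surjective ⟨w, hw⟩
  have h1 : ψ (j y) = w := by
    have := hψ (ej y)
    have h2 : φ (ej y) = w := by
      change ((e (ej.symm (ej y)) : W) : G) = w
      rw [ej.symm_apply_apply, hy]
    rw [h2] at this
    exact this
  have h3 : ψ (π (t, y)) = ∑ k, t k • ψ (π (Pi.single k 1, 0)) + w := by
    have : (t, y) = ∑ k, t k • ((Pi.single k 1 : Fin n → ℝ),
        (0 : Fin (Module.finrank ℝ W) → ℝ)) + (0, y) := by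
      ext
      · simp [Prod.fst_sum, Finset.sum_apply, Pi.single_apply]
      · simp [Prod.snd_sum]
    rw [this, map_add, map_add]
    simp only [map_sum, map_smul]
    rw [← h1]
    rfl
  have h4 : ‖π (t, y)‖ = N (∑ k, t k • f k, w) := by
    rw [hnorm]
    simp [T, Fintype.linearCombination_apply, hy]
  rw [← h3, ← h4, abs_le]
  have := hψn (π (t, y))
  constructor <;> linarith

/-! ### The compact space of amalgams over E -/

section Amalgams

variable {E : Type*} [NormedAddCommGroup E] [NormedSpace ℝ E]
  {F : Type*} [NormedAddCommGroup F] [NormedSpace ℝ F]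
  {G : Type*} [NormedAddCommGroup G] [NormedSpace ℝ G]

/-- A seminorm on `F × G` is an amalgam of `F` and `G` over `E` if it extends both norms and
identifies the two copies of `E`. -/
structure IsAmalgam (φ : E →ₗᵢ[ℝ] F) (ψ : E →ₗᵢ[ℝ] G) (N : Seminorm ℝ (F × G)) : Prop where
  left : ∀ f, N (f, 0) = ‖f‖
  right : ∀ g, N (0, g) = ‖g‖
  base : ∀ e, N (φ e, -ψ e) = 0

/-- The space of amalgams of `F` and `G` over `E`, as a space of functions. -/
def amalgams (φ : E →ₗᵢ[ℝ] F) (ψ : E →ₗᵢ[ℝ] G) : Set (F × G → ℝ) :=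
  {N | ∃ p : Seminorm ℝ (F × G), IsAmalgam φ ψ p ∧ ⇑p = N}

variable {φ : E →ₗᵢ[ℝ] F} {ψ : E →ₗᵢ[ℝ] G} {N : Seminorm ℝ (F × G)}

theorem IsAmalgam.mem_amalgams (hN : IsAmalgam φ ψ N) : ⇑N ∈ amalgams φ ψ := ⟨N, hN, rfl⟩

theorem Seminorm.abs_sub_le_prod (N : Seminorm ℝ (F × G)) (f f' : F) (g g' : G) :
    |N (f, g) - N (f', g')| ≤ N (f - f', g - g') := by
  simpa using abs_sub_map_le_sub N (f, g) (f', g')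

theorem IsAmalgam.add_base (hN : IsAmalgam φ ψ N) (e : E) (f : F) (g : G) :
    N (φ e + f, g) = N (f, ψ e + g) := by
  have := N.abs_sub_le_prod (φ e + f) f g (ψ e + g)
  rw [add_sub_cancel_right, sub_add_cancel_right, hN.base] at this
  exact sub_eq_zero.1 (abs_nonpos_iff.1 this)

theorem IsAmalgam.swap (hN : IsAmalgam φ ψ N) :
    IsAmalgam ψ φ (N.comp (LinearEquiv.prodComm ℝ G F).toLinearMap) where
  left g := by simpa using hN.right g
  right f := by simpa using hN.left f
  base e := by
    have : N (-φ e, ψ e) = 0 := by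
      rw [← map_neg_eq_map N]
      simpa using hN.base e
    simpa using this

theorem swap_mem_amalgams {M : F × G → ℝ} (hM : M ∈ amalgams φ ψ) :
    (fun x => M x.swap) ∈ amalgams ψ φ := by
  obtain ⟨p, hp, rfl⟩ := hM
  exact hp.swap.mem_amalgams

theorem exists_isAmalgam (φ : E →ₗᵢ[ℝ] F) (ψ : E →ₗᵢ[ℝ] G) :
    ∃ N : Seminorm ℝ (F × G), IsAmalgam φ ψ N := by
  obtain ⟨N, h1, h2, h3⟩ := Seminorm.exists_amalgam (normSeminorm ℝ F) (normSeminorm ℝ G) 0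
    φ.toLinearMap ψ.toLinearMap (fun u => by simp)
  exact ⟨N, h1, h2, fun e => le_antisymm (h3 e) (apply_nonneg _ _)⟩

theorem isClosed_amalgams (φ : E →ₗᵢ[ℝ] F) (ψ : E →ₗᵢ[ℝ] G) : IsClosed (amalgams φ ψ) := by
  have : amalgams φ ψ = {N : F × G → ℝ | (∀ x y, N (x + y) ≤ N x + N y) ∧
      (∀ (r : ℝ) x, N (r • x) = ‖r‖ * N x) ∧ (∀ f, N (f, 0) = ‖f‖) ∧ (∀ g, N (0, g) = ‖g‖) ∧
      ∀ e, N (φ e, -ψ e) = 0} := by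
    ext N
    constructor
    · rintro ⟨p, hp, rfl⟩
      exact ⟨map_add_le_add p, map_smul_eq_mul p, hp.left, hp.right, hp.base⟩
    · rintro ⟨h1, h2, h3, h4, h5⟩
      exact ⟨Seminorm.of N h1 h2, ⟨h3, h4, h5⟩, rfl⟩
  rw [this]
  simp only [Set.ofPred_and, Set.ofPred_forall]
  refine IsClosed.inter (isClosed_iInter fun x => isClosed_iInter fun y => ?_) <|
    IsClosed.inter (isClosed_iInter fun r => isClosed_iInter fun x => ?_) <|
    IsClosed.inter (isClosed_iInter fun f => ?_) <|
    IsClosed.inter (isClosed_iInter fun f => ?_) (isClosed_iInter fun f => ?_)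
  · exact isClosed_le (by fun_prop) (by fun_prop)
  all_goals exact isClosed_eq (by fun_prop) (by fun_prop)

/-- Every amalgam is bounded by ‖f‖ + ‖g‖, so Tychonoff applies. Compactness is what supplies the
Baire property later. -/
theorem isCompact_amalgams (φ : E →ₗᵢ[ℝ] F) (ψ : E →ₗᵢ[ℝ] G) : IsCompact (amalgams φ ψ) := by
  refine (isCompact_univ_pi fun x : F × G => isCompact_Icc (a := 0)
    (b := ‖x.1‖ + ‖x.2‖)).of_isClosed_subset (isClosed_amalgams φ ψ) ?_
  rintro _ ⟨p, hp, rfl⟩ x -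
  refine ⟨apply_nonneg _ _, ?_⟩
  rw [← hp.left, ← hp.right]
  refine le_of_eq_of_le (congrArg p ?_) (map_add_le_add p _ _)
  simp

instance (φ : E →ₗᵢ[ℝ] F) (ψ : E →ₗᵢ[ℝ] G) : CompactSpace (amalgams φ ψ) :=
  isCompact_iff_compactSpace.1 (isCompact_amalgams φ ψ)

/-- An amalgam in which `F` lies in the closure of `G` is the graph of an isometric embedding. -/
theorem IsAmalgam.exists_linearIsometry [CompleteSpace G] (hN : IsAmalgam φ ψ N)
    (h : ∀ f, ∀ δ > 0, ∃ g, N (f, -g) < δ) :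
    ∃ χ : F →ₗᵢ[ℝ] G, (∀ e, χ (φ e) = ψ e) ∧ ∀ f g, N (f, g) = ‖χ f + g‖ := by
  have hdist : ∀ f f' g g', ‖g - g'‖ ≤ N (f, -g) + N (f', -g') + ‖f - f'‖ := fun f f' g g' => by
    have h1 : N (0, g - g') ≤ N (-(f, -g)) + N (f', -g') + N (f - f', 0) := by
      refine le_of_eq_of_le (congrArg N ?_) ((map_add_le_add N _ _).trans
        (add_le_add_left (map_add_le_add N _ _) _))
      ext
      · simp
      · simp; abel
    rwa [hN.right, hN.left, map_neg_eq_map] at h1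
  -- Vectors of G within (1/2)^k of f form a Cauchy sequence by `hdist`; the limit is at distance
  -- zero from f.
  have hex : ∀ f, ∃ g, N (f, -g) = 0 := fun f => by
    choose g hg using fun k : ℕ => h f ((1 / 2 : ℝ) ^ k) (by positivity)
    have hcau : CauchySeq g := by
      refine cauchySeq_of_le_tendsto_0 (fun k => (1 / 2 : ℝ) ^ k + (1 / 2) ^ k)
        (fun n m k hn hm => ?_) ?_
      · rw [dist_eq_norm]
        have := hdist f f (g n) (g m)
        rw [sub_self, norm_zero, add_zero] at this
        refine this.trans (add_le_add ((hg n).le.trans ?_) ((hg m).le.trans ?_))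
        · exact pow_le_pow_of_le_one (by norm_num) (by norm_num) hn
        · exact pow_le_pow_of_le_one (by norm_num) (by norm_num) hm
      · have := tendsto_pow_atTop_nhds_zero_of_lt_one (r := (1 / 2 : ℝ)) (by norm_num) (by norm_num)
        simpa using this.add this
    obtain ⟨g₀, hg₀⟩ := cauchySeq_tendsto_of_complete hcau
    refine ⟨g₀, le_antisymm ?_ (apply_nonneg _ _)⟩
    have h2 : Filter.Tendsto (fun k => (1 / 2 : ℝ) ^ k + ‖g k - g₀‖) Filter.atTop (𝓝 (0 + 0)) :=
      (tendsto_pow_atTop_nhds_zero_of_lt_one (by norm_num) (by norm_num)).add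
        (tendsto_iff_norm_sub_tendsto_zero.1 hg₀)
    rw [add_zero] at h2
    refine ge_of_tendsto' h2 fun k => ?_
    have h3 := (abs_le.1 (N.abs_sub_le_prod f f (-g₀) (-g k))).2
    rw [sub_self, neg_sub_neg, hN.right] at h3
    linarith [hg k]
  choose χ hχ using hex
  have huniq : ∀ f g, N (f, -g) = 0 → χ f = g := fun f g hg => by
    have := hdist f f (χ f) g
    rw [hχ, hg, sub_self, norm_zero, add_zero, add_zero] at this
    exact sub_eq_zero.1 (norm_le_zero_iff.1 this)
  have hgraph : ∀ f g, N (f, g) = ‖χ f + g‖ := fun f g => by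
    have := N.abs_sub_le_prod f 0 g (χ f + g)
    rw [sub_zero, sub_add_cancel_right, hχ, hN.right] at this
    exact sub_eq_zero.1 (abs_nonpos_iff.1 this)
  refine ⟨⟨⟨⟨χ, fun f f' => huniq _ _ ?_⟩, fun r f => huniq _ _ ?_⟩, fun f => ?_⟩,
    fun e => huniq _ _ (hN.base e), hgraph⟩
  · refine le_antisymm ?_ (apply_nonneg _ _)
    have := map_add_le_add N (f, -χ f) (f', -χ f')
    rw [hχ, hχ, Prod.mk_add_mk, ← neg_add, add_zero] at this
    exact this
  · have := map_smul_eq_mul N r (f, -χ f)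
    rw [hχ, mul_zero, Prod.smul_mk, smul_neg] at this
    exact this
  · change ‖χ f‖ = ‖f‖
    rw [← add_zero (χ f), ← hgraph, hN.left]

end Amalgams

/-! ### Generic amalgams are embeddings or isomorphisms -/

section BackAndForth

variable {E : Type u} [NormedAddCommGroup E] [NormedSpace ℝ E]
  {F : Type*} [NormedAddCommGroup F] [NormedSpace ℝ F]
  {G : Type*} [NormedAddCommGroup G] [NormedSpace ℝ G]
  {φ : E →ₗᵢ[ℝ] F} {ψ : E →ₗᵢ[ℝ] G}

/-- The extension step: over an atomic extension of `E`, an amalgam with a Gurarij space is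
approximated by amalgams in which a given vector is close to a vector of the Gurarij space. -/
theorem IsAmalgam.exists_extension (hφ : IsAtomicOver φ) (hG : IsGurarij G)
    {N : Seminorm ℝ (F × G)} (hN : IsAmalgam φ ψ N) (f₀ : F) (S : Finset (F × G)) {ε : ℝ}
    (hε : 0 < ε) :
    ∃ N' : Seminorm ℝ (F × G), IsAmalgam φ ψ N' ∧ (∃ g, N' (f₀, -g) < ε) ∧
      ∀ x ∈ S, |N' x - N x| < ε := by
  classical
  let S' : Finset F := insert f₀ (S.image Prod.fst)
  let f : Fin S'.card → F := fun k => S'.equivFin.symm k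
  have hf : ∀ x ∈ S', ∃ k, f k = x := fun x hx => ⟨S'.equivFin ⟨x, hx⟩, by simp [f]⟩
  obtain ⟨T, δ, hδ, hT⟩ := BanachType.mem_nhds_iff.1
    (BanachType.isIsolated_iff.1 (hφ _ f) (ε / 3) (by positivity))
  -- W contains everything on the G side that must be controlled: the second coordinates of S, and
  -- the parameters from E in the conditions T that isolate the type of f.
  let W : Submodule ℝ G := Submodule.span ℝ
    ((S.image Prod.snd ∪ T.image fun x => ψ x.1 : Finset G) : Set G)
  have : FiniteDimensional ℝ W := FiniteDimensional.span_finset ℝ _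
  have hWS : ∀ x ∈ S, x.2 ∈ W := fun x hx => Submodule.subset_span <| by
    simp only [Finset.coe_union, Finset.coe_image]
    exact Or.inl ⟨x, hx, rfl⟩
  have hWT : ∀ x ∈ T, ψ x.1 ∈ W := fun x hx => Submodule.subset_span <| by
    simp only [Finset.coe_union, Finset.coe_image]
    exact Or.inr ⟨x, hx, rfl⟩
  obtain ⟨η₁, hη₁, hS₁⟩ := exists_pos_forall_mul_lt S (fun x => N x) (show 0 < ε / 3 by positivity)
  obtain ⟨η₂, hη₂, hT₂⟩ := exists_pos_forall_mul_lt T (fun x => (typeOf φ f).toSeminorm x) hδ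
  obtain ⟨c, hc⟩ := hG.exists_tuple N hN.right f W (lt_min hη₁ hη₂)
  -- The imitation c satisfies the finitely many conditions T up to δ; isolation of the type of f
  -- upgrades this to uniform closeness.
  have hclose : BanachType.Close (ε / 3) (typeOf φ f) (typeOf ψ c) := by
    refine hT _ fun x hx => ?_
    have h1 := hc x.2 (ψ x.1) (hWT x hx)
    have h2 : N (∑ k, x.2 k • f k, ψ x.1) = (typeOf φ f).toSeminorm x := by
      rw [typeOf_apply, ← hN.left, hN.add_base, add_zero]
    rw [h2, add_comm] at h1
    rw [typeOf_apply ψ]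
    exact (h1.trans (mul_le_mul_of_nonneg_right (min_le_right _ _) (apply_nonneg _ _))).trans_lt
      (hT₂ x hx)
  have hε3 : (0 : ℝ) ≤ ε / 3 := by positivity
  obtain ⟨N', hl, hr, hb⟩ := Seminorm.exists_amalgam (normSeminorm ℝ F) (normSeminorm ℝ G)
    (coeffSeminorm E S'.card (ε / 3) hε3)
    (φ.toLinearMap.coprod (Fintype.linearCombination ℝ f))
    (ψ.toLinearMap.coprod (Fintype.linearCombination ℝ c)) (fun x => hclose x.1 x.2)
  have hb' : ∀ k, N' (f k, -c k) ≤ ε / 3 := fun k => by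
    have := hb (0, Pi.single k 1)
    simpa [Pi.single_apply, apply_ite abs] using this
  refine ⟨N', ⟨hl, hr, fun e => le_antisymm ?_ (apply_nonneg _ _)⟩, ?_, fun x hx => ?_⟩
  · simpa using hb (e, 0)
  · obtain ⟨k, hk⟩ := hf f₀ (Finset.mem_insert_self _ _)
    exact ⟨c k, by rw [← hk]; exact (hb' k).trans_lt (by linarith)⟩
  -- Both values are compared with ‖c k + x.2‖: the new amalgam differs from it by at most ε/3 since
  -- f k and c k are that close, the old one by less than ε/3 by the choice of c.
  · obtain ⟨k, hk⟩ := hf x.1 (Finset.mem_insert_of_mem (Finset.mem_image_of_mem _ hx))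
    have h1 : N' (0, c k + x.2) = ‖c k + x.2‖ := hr _
    have h2 := N'.abs_sub_le_prod x.1 0 x.2 (c k + x.2)
    rw [sub_zero, sub_add_cancel_right, ← hk, h1] at h2
    have h3 := hc (Pi.single k 1) x.2 (hWS x hx)
    simp only [Pi.single_apply, ite_smul, one_smul, zero_smul, Finset.sum_ite_eq',
      Finset.mem_univ, if_true] at h3
    have h4 : (f k, x.2) = x := by rw [hk]
    rw [h4] at h2 h3
    have h5 := h3.trans_lt ((mul_le_mul_of_nonneg_right (min_le_left _ _)
      (apply_nonneg N x)).trans_lt (hS₁ x hx))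
    have h6 := h2.trans (hb' k)
    rw [abs_le] at h6
    rw [abs_lt] at h5 ⊢
    constructor <;> linarith

theorem dense_amalgams_of_forall_finset {P : Set (amalgams φ ψ)}
    (h : ∀ N, IsAmalgam φ ψ N → ∀ S : Finset (F × G), ∀ ε > 0,
      ∃ N', ∃ hN' : IsAmalgam φ ψ N', ⟨N', hN'.mem_amalgams⟩ ∈ P ∧ ∀ x ∈ S, |N' x - N x| < ε) :
    Dense P := by
  rintro ⟨_, N, hN, rfl⟩
  refine mem_closure_iff_nhds.2 fun U hU => ?_
  obtain ⟨S, ε, hε, hS⟩ := IsInducing.subtypeVal.mem_nhds_iff_exists_finset.1 hU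
  obtain ⟨N', hN', hP, hle⟩ := h N hN S ε hε
  exact ⟨_, hS ⟨N', hN'.mem_amalgams⟩ hle, hP⟩

-- Countably many dense open conditions, one for each member of a dense sequence of F and each
-- tolerance 1/(k+1), suffice.
open TopologicalSpace in
theorem eventually_residual_amalgams [SeparableSpace F] (hφ : IsAtomicOver φ) (hG : IsGurarij G) :
    ∀ᶠ N : amalgams φ ψ in residual _, ∀ f, ∀ δ > 0, ∃ g, N.1 (f, -g) < δ := by
  have hev : ∀ᶠ N : amalgams φ ψ in residual _, ∀ (m k : ℕ),
      ∃ g, N.1 (denseSeq F m, -g) < 1 / ((k : ℝ) + 1) := by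
    refine eventually_countable_forall.2 fun m => eventually_countable_forall.2 fun k => ?_
    refine residual_of_dense_open ?_ (dense_amalgams_of_forall_finset fun N hN S ε hε => ?_)
    · simp only [Set.ofPred_exists]
      refine isOpen_iUnion fun g => isOpen_lt ?_ continuous_const
      exact (continuous_apply _).comp continuous_subtype_val
    · obtain ⟨N', hN', ⟨g, hg⟩, h⟩ := hN.exists_extension hφ hG (denseSeq F m) S
        (lt_min hε (show 0 < 1 / ((k : ℝ) + 1) by positivity))
      exact ⟨N', hN', ⟨g, hg.trans_le (min_le_right _ _)⟩,
        fun x hx => (h x hx).trans_le (min_le_left _ _)⟩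
  refine hev.mono ?_
  rintro ⟨_, N, hN, rfl⟩ h f δ hδ
  obtain ⟨k, hk⟩ := exists_nat_one_div_lt (half_pos hδ)
  obtain ⟨m, hm⟩ := (denseRange_denseSeq F).exists_dist_lt f (half_pos hδ)
  obtain ⟨g, hg⟩ := h m k
  refine ⟨g, ?_⟩
  have h1 := (abs_le.1 (N.abs_sub_le_prod f (denseSeq F m) (-g) (-g))).2
  rw [sub_self, hN.left, ← dist_eq_norm] at h1
  simp only at hg ⊢
  linarith

open TopologicalSpace in
/-- Every amalgam of an atomic extension with a Gurarij space is approximated by isometric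
embeddings over the base. -/
theorem IsAmalgam.exists_linearIsometry_near [SeparableSpace F] (hφ : IsAtomicOver φ)
    (hG : IsGurarij G) {N : Seminorm ℝ (F × G)} (hN : IsAmalgam φ ψ N) (S : Finset (F × G))
    {ε : ℝ} (hε : 0 < ε) :
    ∃ χ : F →ₗᵢ[ℝ] G, (∀ e, χ (φ e) = ψ e) ∧ ∀ x ∈ S, |‖χ x.1 + x.2‖ - N x| < ε := by
  have := hG.complete
  have hnhds : {M : amalgams φ ψ | ∀ x ∈ S, dist (M.1 x) (N x) < ε}
      ∈ 𝓝 (⟨N, hN.mem_amalgams⟩ : amalgams φ ψ) :=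
    IsInducing.subtypeVal.mem_nhds_iff_exists_finset.2 ⟨S, ε, hε, fun M hM => hM⟩
  obtain ⟨⟨_, M, hM, rfl⟩, hMS, h⟩ := mem_closure_iff_nhds.1
    (dense_of_mem_residual (eventually_residual_amalgams hφ hG) ⟨N, hN.mem_amalgams⟩) _ hnhds
  obtain ⟨χ, hχ, hgr⟩ := hM.exists_linearIsometry h
  exact ⟨χ, hχ, fun x hx => by rw [← hgr]; exact hMS x hx⟩

open TopologicalSpace in
/-- Every amalgam of two atomic separable Gurarij extensions is approximated by isometric
isomorphisms over the base. -/
theorem IsAmalgam.exists_linearIsometryEquiv_near [SeparableSpace F] [SeparableSpace G]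
    (hφ : IsAtomicOver φ) (hψ : IsAtomicOver ψ) (hF : IsGurarij F) (hG : IsGurarij G)
    {N : Seminorm ℝ (F × G)} (hN : IsAmalgam φ ψ N) (S : Finset (F × G)) {ε : ℝ} (hε : 0 < ε) :
    ∃ χ : F ≃ₗᵢ[ℝ] G, (∀ e, χ (φ e) = ψ e) ∧ ∀ x ∈ S, |‖χ x.1 + x.2‖ - N x| < ε := by
  have := hG.complete
  have := hF.complete
  let sw : amalgams φ ψ ≃ₜ amalgams ψ φ :=
    { toFun := fun M => ⟨_, swap_mem_amalgams M.2⟩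
      invFun := fun M => ⟨_, swap_mem_amalgams M.2⟩
      left_inv := fun M => rfl
      right_inv := fun M => rfl
      continuous_toFun := continuous_induced_rng.2 (continuous_pi fun x =>
        (continuous_apply x.swap).comp continuous_subtype_val)
      continuous_invFun := continuous_induced_rng.2 (continuous_pi fun x =>
        (continuous_apply x.swap).comp continuous_subtype_val) }
  have hsw : ∀ᶠ M : amalgams φ ψ in residual _, ∀ g, ∀ δ > 0, ∃ f, M.1 (-f, g) < δ := by
    obtain ⟨t, ht, hGδ, hd⟩ := mem_residual.1 (eventually_residual_amalgams (ψ := φ) hψ hF)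
    refine mem_residual.2 ⟨sw ⁻¹' t, fun M hM => ht hM, hGδ.preimage sw.continuous, ?_⟩
    exact hd.preimage sw.isOpenMap
  have hnhds : {M : amalgams φ ψ | ∀ x ∈ S, dist (M.1 x) (N x) < ε}
      ∈ 𝓝 (⟨N, hN.mem_amalgams⟩ : amalgams φ ψ) :=
    IsInducing.subtypeVal.mem_nhds_iff_exists_finset.2 ⟨S, ε, hε, fun M hM => hM⟩
  obtain ⟨⟨_, M, hM, rfl⟩, hMS, h, h'⟩ := mem_closure_iff_nhds.1
    (dense_of_mem_residual ((eventually_residual_amalgams hφ hG).and hsw)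
      ⟨N, hN.mem_amalgams⟩) _ hnhds
  obtain ⟨χ, hχ, hgr⟩ := hM.exists_linearIsometry h
  -- The swapped generic condition makes the range dense, and the range is closed because F is
  -- complete.
  have hsurj : Function.Surjective χ := by
    have hcl : IsClosed (Set.range χ) := χ.isometry.isClosedEmbedding.isClosed_range
    rw [← Set.range_eq_univ, ← hcl.closure_eq, ← denseRange_iff_closure_range]
    refine Metric.denseRange_iff.2 fun g δ hδ => ?_
    obtain ⟨f, hf⟩ := h' g δ hδ
    refine ⟨f, ?_⟩
    simp only at hf
    rwa [hgr, map_neg, neg_add_eq_sub, ← dist_eq_norm] at hf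
  exact ⟨LinearIsometryEquiv.ofSurjective χ hsurj, hχ,
    fun x hx => by
      rw [LinearIsometryEquiv.coe_ofSurjective, ← hgr]; exact hMS x hx⟩

end BackAndForth

/-! ### Transport along isometries, uniqueness and universes -/

section Transfer

variable {E : Type u} [NormedAddCommGroup E] [NormedSpace ℝ E]
  {F : Type v} [NormedAddCommGroup F] [NormedSpace ℝ F]
  {G : Type w} [NormedAddCommGroup G] [NormedSpace ℝ G]

theorem typeOf_comp (χ : F →ₗᵢ[ℝ] G) (i : E →ₗᵢ[ℝ] F) {n : ℕ} (a : Fin n → F) :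
    typeOf (χ.comp i) (fun k => χ (a k)) = typeOf i a := by
  ext x
  rw [typeOf_apply, typeOf_apply, ← χ.norm_map]
  simp

theorem BanachType.IsRealisedBy.typeOf_eq {n : ℕ} {ξ : BanachType E n} {i : E →ₗᵢ[ℝ] F}
    {a : Fin n → F} (h : ξ.IsRealisedBy i a) : typeOf i a = ξ := by
  ext x
  rw [typeOf_apply, h x.1 x.2]

theorem IsAtomicOver.comp_equiv {i : E →ₗᵢ[ℝ] F} (hi : IsAtomicOver i) (h : F ≃ₗᵢ[ℝ] G) :
    IsAtomicOver (h.toLinearIsometry.comp i) := fun n a => by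
  rw [← show (fun k => h.toLinearIsometry (h.symm (a k))) = a from funext fun k => by simp,
    typeOf_comp]
  exact hi n _

theorem IsGurarij.of_equiv (hF : IsGurarij F) (h : F ≃ₗᵢ[ℝ] G) : IsGurarij G where
  complete := by
    have := hF.complete
    exact (completeSpace_congr (e := h.toEquiv) h.isometry.isUniformEmbedding).1 this
  exists_extension ε hε B _ _ _ A φ := by
    obtain ⟨ψ, h1, h2⟩ := hF.exists_extension ε hε B A (h.symm.toLinearIsometry.comp φ)
    refine ⟨h.toLinearEquiv.toLinearMap ∘ₗ ψ, fun x => ?_, fun x => ?_⟩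
    · change h (ψ x) = φ x
      rw [h1]
      simp
    · change (1 - ε) * ‖x‖ ≤ ‖h (ψ x)‖ ∧ ‖h (ψ x)‖ ≤ _
      rw [h.norm_map]
      exact h2 x

/-- The separable Gurarij space is unique up to linear isometry. -/
theorem IsGurarij.nonempty_linearIsometryEquiv [TopologicalSpace.SeparableSpace F]
    [TopologicalSpace.SeparableSpace G] (hF : IsGurarij F) (hG : IsGurarij G) :
    Nonempty (F ≃ₗᵢ[ℝ] G) := by
  let φ : PUnit.{1} →ₗᵢ[ℝ] F := ⟨0, fun x => by simp⟩
  let ψ : PUnit.{1} →ₗᵢ[ℝ] G := ⟨0, fun x => by simp⟩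
  obtain ⟨N, hN⟩ := exists_isAmalgam φ ψ
  obtain ⟨χ, -, -⟩ := hN.exists_linearIsometryEquiv_near (.of_subsingleton φ) (.of_subsingleton ψ)
    hF hG ∅ one_pos
  exact ⟨χ⟩

/-- The Kuratowski embedding lands in bounded real sequences, which live in the lowest universe. -/
theorem small_of_separable (X : Type w) [MetricSpace X] [TopologicalSpace.SeparableSpace X] :
    Small.{u} X := by
  obtain ⟨f, hf⟩ := KuratowskiEmbedding.exists_isometric_embedding X
  exact small_of_injective hf.injective

theorem existsAtomicGurarij_of_isAtomicOver [TopologicalSpace.SeparableSpace G]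
    (hG : IsGurarij G) {φ : E →ₗᵢ[ℝ] G} (hφ : IsAtomicOver φ) : ExistsAtomicGurarij E := by
  have : Small.{u} G := small_of_separable G
  let e : G ≃ₗᵢ[ℝ] Shrink.{u} G :=
    ⟨(Shrink.linearEquiv ℝ G).symm, fun x => by
      change ‖(equivShrink G).symm (equivShrink G x)‖ = ‖x‖
      simp⟩
  exact ⟨Shrink.{u} G, inferInstance, inferInstance, e.toLinearIsometry.comp φ,
    e.surjective.denseRange.separableSpace e.continuous, hG.of_equiv e, hφ.comp_equiv e⟩

end Transfer

/-! ### The space of embeddings and its orbits -/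

section EmbeddingSpace

open TopologicalSpace

variable {E : Type u} [NormedAddCommGroup E] [NormedSpace ℝ E]
  {G : Type v} [NormedAddCommGroup G] [NormedSpace ℝ G]

theorem LinearIsometry.isInducing_coe :
    IsInducing fun (φ : E →ₗᵢ[ℝ] G) (x : E) => φ x := ⟨rfl⟩

theorem LinearIsometryEquiv.isInducing_coe :
    IsInducing fun (h : G ≃ₗᵢ[ℝ] G) (x : G) => h x := ⟨rfl⟩

theorem LinearIsometry.continuous_eval (x : E) : Continuous fun φ : E →ₗᵢ[ℝ] G => φ x :=
  (continuous_apply x).comp LinearIsometry.isInducing_coe.continuous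

theorem LinearIsometry.mem_nhds_iff {φ : E →ₗᵢ[ℝ] G} {s : Set (E →ₗᵢ[ℝ] G)} :
    s ∈ 𝓝 φ ↔ ∃ T : Finset E, ∃ ε > 0, ∀ ψ : E →ₗᵢ[ℝ] G, (∀ x ∈ T, ‖ψ x - φ x‖ < ε) → ψ ∈ s := by
  simp only [LinearIsometry.isInducing_coe.mem_nhds_iff_exists_finset, dist_eq_norm]

theorem continuousSMul_linearIsometry :
    ContinuousSMul (G ≃ₗᵢ[ℝ] G) (E →ₗᵢ[ℝ] G) where
  continuous_smul := by
    refine LinearIsometry.isInducing_coe.continuous_iff.2 (continuous_pi fun x => ?_)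
    refine continuous_iff_continuousAt.2 fun ⟨h₀, φ₀⟩ => tendsto_iff_dist_tendsto_zero.2 ?_
    have h1 : Continuous fun p : (G ≃ₗᵢ[ℝ] G) × (E →ₗᵢ[ℝ] G) =>
        dist (p.2 x) (φ₀ x) + dist (p.1 (φ₀ x)) (h₀ (φ₀ x)) := by
      have h2 : Continuous fun p : (G ≃ₗᵢ[ℝ] G) × (E →ₗᵢ[ℝ] G) => p.2 x :=
        (LinearIsometry.continuous_eval x).comp continuous_snd
      have h3 : Continuous fun p : (G ≃ₗᵢ[ℝ] G) × (E →ₗᵢ[ℝ] G) => p.1 (φ₀ x) :=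
        (continuous_apply (φ₀ x)).comp
          (LinearIsometryEquiv.isInducing_coe.continuous.comp continuous_fst)
      fun_prop
    refine squeeze_zero (fun _ => dist_nonneg) (fun p => ?_)
      (by simpa using h1.tendsto (h₀, φ₀))
    change dist (p.1 (p.2 x)) (h₀ (φ₀ x)) ≤ _
    refine (dist_triangle _ (p.1 (φ₀ x)) _).trans (le_of_eq ?_)
    rw [p.1.dist_map]

theorem LinearIsometry.dist_map_le_of_approx (φ ψ : E →ₗᵢ[ℝ] G) (x y : E) :
    dist (φ x) (ψ x) ≤ 2 * dist x y + dist (φ y) (ψ y) := by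
  have h1 := dist_triangle4 (φ x) (φ y) (ψ y) (ψ x)
  rw [φ.dist_map, ψ.dist_map, dist_comm y x] at h1
  linarith

/-- Evaluation on a dense sequence of E is a closed embedding in G^ℕ: isometries are uniformly
equicontinuous, so pointwise convergence on the sequence spreads to E, and the limit is again a
linear isometry. -/
theorem polishSpace_linearIsometry [SeparableSpace E] [SeparableSpace G] [CompleteSpace G] :
    PolishSpace (E →ₗᵢ[ℝ] G) := by
  have : SecondCountableTopology G := UniformSpace.secondCountable_of_separable G
  let d := denseSeq E
  have hd : DenseRange d := denseRange_denseSeq E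
  let Φ : (E →ₗᵢ[ℝ] G) → ℕ → G := fun φ k => φ (d k)
  have hcont : Continuous Φ := continuous_pi fun k => LinearIsometry.continuous_eval (d k)
  refine IsClosedEmbedding.polishSpace (f := Φ) ⟨⟨isInducing_iff_nhds.2 fun φ => ?_, ?_⟩, ?_⟩
  · refine le_antisymm hcont.continuousAt.le_comap fun s hs => ?_
    obtain ⟨T, ε, hε, hT⟩ := LinearIsometry.mem_nhds_iff.1 hs
    choose k hk using fun x : E => hd.exists_dist_lt x (show 0 < ε / 3 by positivity)
    classical
    refine Filter.mem_comap.2 ⟨{y | ∀ i ∈ T.image k, dist (y i) (Φ φ i) < ε / 3},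
      mem_nhds_pi_iff_exists_finset.2 ⟨_, _, by positivity, fun y hy => hy⟩,
      fun ψ hψ => hT ψ fun x hx => ?_⟩
    have h1 := hψ (k x) (Finset.mem_image_of_mem _ hx)
    have h2 := ψ.dist_map_le_of_approx φ x (d (k x))
    rw [← dist_eq_norm]
    change dist (ψ (d (k x))) (φ (d (k x))) < ε / 3 at h1
    linarith [hk x]
  · intro φ ψ h
    exact LinearIsometry.ext fun x => congrFun
      (hd.equalizer φ.continuous ψ.continuous (funext fun k => congrFun h k)) x
  · refine IsSeqClosed.isClosed fun y y₀ hy hlim => ?_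
    choose φ hφ using hy
    have hlim' : ∀ k, Filter.Tendsto (fun n => φ n (d k)) Filter.atTop (𝓝 (y₀ k)) := fun k => by
      have := (tendsto_pi_nhds.1 hlim) k
      refine this.congr fun n => ?_
      rw [← hφ]
    have hcau : ∀ x, CauchySeq fun n => φ n x := fun x => by
      refine Metric.cauchySeq_iff.2 fun ε hε => ?_
      obtain ⟨k, hk⟩ := hd.exists_dist_lt x (show 0 < ε / 3 by positivity)
      obtain ⟨M, hM⟩ := Metric.cauchySeq_iff.1 (hlim' k).cauchySeq (ε / 3) (by positivity)
      refine ⟨M, fun m hm n hn => ?_⟩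
      have := (φ m).dist_map_le_of_approx (φ n) x (d k)
      linarith [hM m hm n hn]
    choose χ hχ using fun x => cauchySeq_tendsto_of_complete (hcau x)
    refine ⟨⟨⟨⟨χ, fun x x' => ?_⟩, fun r x => ?_⟩, fun x => ?_⟩, funext fun k =>
      tendsto_nhds_unique (hχ (d k)) (hlim' k)⟩
    · exact tendsto_nhds_unique (hχ (x + x')) (by simpa using (hχ x).add (hχ x'))
    · exact tendsto_nhds_unique (hχ (r • x)) (by simpa using (hχ x).const_smul r)
    · exact tendsto_nhds_unique (hχ x).norm (by simp)

theorem IsGurarij.dense_orbit [SeparableSpace G] (hG : IsGurarij G) (φ : E →ₗᵢ[ℝ] G) :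
    Dense (MulAction.orbit (G ≃ₗᵢ[ℝ] G) φ) := by
  classical
  intro ψ
  refine mem_closure_iff_nhds.2 fun U hU => ?_
  obtain ⟨T, ε, hε, hT⟩ := LinearIsometry.mem_nhds_iff.1 hU
  obtain ⟨N, hN⟩ := exists_isAmalgam φ ψ
  let z : PUnit.{1} →ₗᵢ[ℝ] G := ⟨0, fun x => by simp⟩
  -- N identifies φ e with ψ e, but is now regarded as an amalgam over the trivial space. There
  -- atomicity is automatic, and approximating N by an automorphism h brings h (φ e) close to ψ e.
  have hN' : IsAmalgam z z N := ⟨hN.left, hN.right, fun e => by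
    rw [Subsingleton.elim e 0, map_zero, neg_zero]
    exact map_zero N⟩
  obtain ⟨h, -, hh⟩ := hN'.exists_linearIsometryEquiv_near (.of_subsingleton z)
    (.of_subsingleton z) hG hG (T.image fun e => (φ e, -ψ e)) hε
  refine ⟨h • φ, hT _ fun x hx => ?_, MulAction.mem_orbit _ _⟩
  have := (abs_lt.1 (hh _ (Finset.mem_image_of_mem _ hx))).2
  rw [hN.base, sub_zero, ← sub_eq_add_neg] at this
  exact this

theorem continuous_typeOf {n : ℕ} (a : Fin n → G) :
    Continuous fun φ : E →ₗᵢ[ℝ] G => typeOf φ a := by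
  refine BanachType.isInducing_toSeminorm.continuous_iff.2 (continuous_pi fun x => ?_)
  simp only [Function.comp_apply, typeOf_apply]
  exact ((LinearIsometry.continuous_eval x.1).add continuous_const).norm

/-- Any two atomic embeddings in the separable Gurarij space are conjugate. -/
theorem IsGurarij.orbit_eq_of_isAtomicOver [SeparableSpace G] (hG : IsGurarij G)
    {φ₀ : E →ₗᵢ[ℝ] G} (h₀ : IsAtomicOver φ₀) :
    {φ : E →ₗᵢ[ℝ] G | IsAtomicOver φ} = MulAction.orbit (G ≃ₗᵢ[ℝ] G) φ₀ := by
  ext φ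
  constructor
  · intro hφ
    obtain ⟨N, hN⟩ := exists_isAmalgam φ₀ φ
    obtain ⟨h, hh, -⟩ := hN.exists_linearIsometryEquiv_near h₀ hφ hG hG ∅ one_pos
    exact ⟨h, LinearIsometry.ext hh⟩
  · rintro ⟨h, rfl⟩
    exact h₀.comp_equiv h

end EmbeddingSpace

/-! ### Atomic embeddings are G_δ, and non-isolated types are omitted generically -/

section ApproximateRealisation

open TopologicalSpace

variable {E : Type u} [NormedAddCommGroup E] [NormedSpace ℝ E]
  {G : Type v} [NormedAddCommGroup G] [NormedSpace ℝ G] {n : ℕ}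

/-- Types close to `tp(a/φE)` are realised in extensions which amalgamate approximately with `φ`
and `a`. -/
theorem eventually_exists_realisation_amalgam [SeparableSpace E] (φ : E →ₗᵢ[ℝ] G) (a : Fin n → G)
    (S : Finset E) {s : ℝ} (hs : 0 < s) :
    ∀ᶠ ζ in 𝓝 (typeOf φ a), ∃ (F : Type u) (_ : NormedAddCommGroup F) (_ : NormedSpace ℝ F)
      (i : E →ₗᵢ[ℝ] F) (c : Fin n → F) (N : Seminorm ℝ (F × G)),
      SeparableSpace F ∧ ζ.IsRealisedBy i c ∧ (∀ f, N (f, 0) = ‖f‖) ∧ (∀ g, N (0, g) = ‖g‖) ∧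
      (∀ e ∈ S, N (i e, -φ e) ≤ s) ∧ ∀ k, N (c k, -a k) ≤ s := by
  classical
  let e : Fin S.card → E := fun k => S.equivFin.symm k
  let L : PUnit.{1} × (Fin (S.card + n) → ℝ) →ₗ[ℝ] E × (Fin n → ℝ) :=
    ((Fintype.linearCombination ℝ e ∘ₗ LinearMap.funLeft ℝ ℝ (Fin.castAdd n)).prod
      (LinearMap.funLeft ℝ ℝ (Fin.natAdd S.card))) ∘ₗ LinearMap.snd ℝ _ _
  -- R forgets all of E except the finite tuple S, which joins the variables. The result is a type
  -- over the trivial space, hence isolated, so ζ near tp(a/φE) yields uniform closeness on the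
  -- tuple (S, x).
  let R : BanachType E n → BanachType PUnit.{1} (S.card + n) := fun ζ =>
    ⟨ζ.toSeminorm.comp L, fun b => by
      rw [Subsingleton.elim b 0]
      exact map_zero _⟩
  have hR : Continuous R := BanachType.isInducing_toSeminorm.continuous_iff.2
    (continuous_pi fun x => BanachType.continuous_toSeminorm (L x))
  filter_upwards [hR.continuousAt (BanachType.isIsolated_iff.1
    (BanachType.isIsolated_of_subsingleton (R (typeOf φ a))) s hs)] with ζ hζ
  obtain ⟨F, _, _, π, hsurj, hπ⟩ := ζ.toSeminorm.exists_normed_quotient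
  let i : E →ₗᵢ[ℝ] F := ⟨π ∘ₗ LinearMap.inl ℝ _ _, fun b => by simp [hπ, ζ.extends_norm]⟩
  let c : Fin n → F := fun k => π (0, Pi.single k 1)
  have hπ' : ∀ x, π x = i x.1 + ∑ k, x.2 k • c k := fun x => by
    have : x = (x.1, 0) + ∑ k, x.2 k • ((0 : E), (Pi.single k 1 : Fin n → ℝ)) := by
      ext
      · simp [Prod.fst_sum]
      · simp [Prod.snd_sum, Finset.sum_apply, Pi.single_apply]
    conv_lhs => rw [this]
    simp only [map_add, map_sum, map_smul]
    rfl
  have hcont : Continuous π := by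
    rw [show ⇑π = fun x => i x.1 + ∑ k, x.2 k • c k from funext hπ']
    have := i.continuous
    fun_prop
  obtain ⟨N, h1, h2, h3⟩ := Seminorm.exists_amalgam (normSeminorm ℝ F) (normSeminorm ℝ G)
    (coeffSeminorm PUnit.{1} (S.card + n) s hs.le) (π ∘ₗ L)
    (φ.toLinearMap.coprod (Fintype.linearCombination ℝ a) ∘ₗ L) (fun x => by
      have := hζ.symm x.1 x.2
      refine le_of_eq_of_le (congrArg abs (congrArg₂ _ ?_ ?_)) this
      · exact hπ _
      · rfl)
  have hL : ∀ k, L (0, Pi.single (Fin.castAdd n k) 1) = (e k, 0) := fun k => by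
    ext j
    · simp [L, Fintype.linearCombination_apply, LinearMap.funLeft_apply, Pi.single_apply]
    · simp [L, LinearMap.funLeft_apply, Pi.single_apply, Fin.ext_iff]
      omega
  have hL' : ∀ k, L (0, Pi.single (Fin.natAdd S.card k) 1) = (0, Pi.single k 1) := fun k => by
    ext j
    · change ∑ j, (Pi.single (Fin.natAdd S.card k) 1 : Fin (S.card + n) → ℝ) (Fin.castAdd n j) • e j
        = 0
      refine Finset.sum_eq_zero fun j _ => ?_
      rw [Pi.single_apply, if_neg, zero_smul]
      simp only [Fin.ext_iff, Fin.val_castAdd, Fin.val_natAdd]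
      omega
    · simp [L, LinearMap.funLeft_apply, Pi.single_apply]
  have h3' : ∀ k, N (π (L (0, Pi.single k 1)),
      -(φ (L (0, Pi.single k 1)).1 + ∑ j, (L (0, Pi.single k 1)).2 j • a j)) ≤ s := fun k => by
    have := h3 (0, Pi.single k 1)
    simp only [coeffSeminorm_apply, Pi.single_apply, apply_ite abs, abs_one, abs_zero,
      Finset.sum_ite_eq', Finset.mem_univ, if_true, mul_one] at this
    exact this
  refine ⟨F, _, _, i, c, N, hsurj.denseRange.separableSpace hcont,
    fun b t => by rw [← hπ, hπ'], h1, h2, fun x hx => ?_, fun k => ?_⟩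
  · have := h3' (Fin.castAdd n (S.equivFin ⟨x, hx⟩))
    rw [hL] at this
    simpa [e, hπ'] using this
  · have := h3' (Fin.natAdd S.card k)
    rw [hL'] at this
    simpa [hπ', Pi.single_apply] using this

/-- The union of the open sets of types all of whose members are `r`-close. -/
def smallOpens (E : Type u) [NormedAddCommGroup E] [NormedSpace ℝ E] (n : ℕ) (r : ℝ) :
    Set (BanachType E n) :=
  ⋃₀ {V | IsOpen V ∧ ∀ ζ ∈ V, ∀ χ ∈ V, BanachType.Close r ζ χ}

theorem isOpen_smallOpens (n : ℕ) (r : ℝ) : IsOpen (smallOpens E n r) :=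
  isOpen_sUnion fun _ h => h.1

theorem BanachType.IsIsolated.mem_smallOpens {ξ : BanachType E n} (h : ξ.IsIsolated) {r : ℝ}
    (hr : 0 < r) : ξ ∈ smallOpens E n r := by
  refine ⟨interior {ζ | Close (r / 2) ξ ζ}, ⟨isOpen_interior, fun ζ hζ χ hχ => ?_⟩,
    mem_interior_iff_mem_nhds.2 (isIsolated_iff.1 h _ (half_pos hr))⟩
  exact ((interior_subset hζ).symm.trans (interior_subset hχ)).mono (by linarith)

/-- A tuple has isolated type if nearby tuples have types in small open sets. -/
theorem isIsolated_typeOf_of_approx [SeparableSpace E] (φ : E →ₗᵢ[ℝ] G) (a : Fin n → G)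
    (h : ∀ r > 0, ∃ a' : Fin n → G, (∀ k, ‖a k - a' k‖ ≤ r) ∧ typeOf φ a' ∈ smallOpens E n r) :
    (typeOf φ a).IsIsolated := by
  classical
  refine BanachType.isIsolated_iff.2 fun s hs => ?_
  -- The budget is s/4 from a to a', s/4 between two types in V, and s/2 from a' to a realisation c
  -- of ζ, which is within s/4 of a in an amalgam.
  obtain ⟨a', ha', V, ⟨hVo, hV⟩, haV⟩ := h (s / 4) (by positivity)
  obtain ⟨T, δ, hδ, hT⟩ := BanachType.mem_nhds_iff.1 (hVo.mem_nhds haV)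
  filter_upwards [eventually_exists_realisation_amalgam φ a (T.image Prod.fst)
    (lt_min (half_pos hδ) (show 0 < s / 4 by positivity))] with ζ hζ
  obtain ⟨F, _, _, i, c, N, -, hreal, h1, h2, h3, h4⟩ := hζ
  obtain ⟨K, _, _, π, -, hπ⟩ := N.exists_normed_quotient
  let j : E →ₗᵢ[ℝ] K := ⟨π ∘ₗ LinearMap.inl ℝ _ _ ∘ₗ i.toLinearMap, fun e => by simp [hπ, h1]⟩
  have hj : ∀ (b : E) (t : Fin n → ℝ), j b + ∑ k, t k • π (0, a' k) = π (i b, ∑ k, t k • a' k) := by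
    intro b t
    have : (i b, ∑ k, t k • a' k) = (i b, 0) + ∑ k, t k • ((0 : F), a' k) := by
      ext
      · simp [Prod.fst_sum]
      · simp [Prod.snd_sum]
    rw [this, map_add]
    simp only [map_sum, map_smul]
    rfl
  have hζj : ζ.IsRealisedBy j fun k => π (c k, 0) := fun b t => by
    rw [hreal b t, ← h1]
    have : (i b + ∑ k, t k • c k, (0 : G)) = (i b, 0) + ∑ k, t k • (c k, (0 : G)) := by
      ext
      · simp [Prod.fst_sum]
      · simp [Prod.snd_sum]
    rw [← hπ, this, map_add]
    simp only [map_sum, map_smul]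
    rfl
  -- Replacing φ by j moves the relevant parameters of E by at most δ/2, so the type of a' stays in
  -- V.
  have hmem : typeOf j (fun k => π (0, a' k)) ∈ V := by
    refine hT _ fun x hx => ?_
    rw [typeOf_apply, typeOf_apply, hj, hπ, ← h2]
    refine (N.abs_sub_le_prod _ _ _ _).trans_lt ?_
    rw [sub_zero, sub_add_cancel_right]
    exact ((h3 _ (Finset.mem_image_of_mem _ hx)).trans (min_le_left _ _)).trans_lt (by linarith)
  have hc1 : BanachType.Close (s / 4) (typeOf φ a) (typeOf φ a') :=
    (typeOf_isRealisedBy φ a).close (typeOf_isRealisedBy φ a') ha'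
  have hc2 := hV _ haV _ hmem
  have hc3 : BanachType.Close (s / 2) (typeOf j fun k => π (0, a' k)) ζ := by
    refine (typeOf_isRealisedBy _ _).close hζj fun k => ?_
    rw [norm_sub_rev, ← map_sub, hπ, Prod.mk_sub_mk, sub_zero, zero_sub]
    have h5 := (abs_le.1 (N.abs_sub_le_prod (c k) (c k) (-a' k) (-a k))).2
    rw [sub_self, neg_sub_neg, h2] at h5
    linarith [ha' k, (h4 k).trans (min_le_right _ _)]
  exact ((hc1.trans hc2).trans hc3).mono (by linarith)

/-- By `isIsolated_typeOf_of_approx`, only tuples from a dense sequence and tolerances 1/(k+1) need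
testing. For fixed a' the condition is open, since the type of a' depends continuously on φ. -/
theorem isGδ_setOf_isAtomicOver [SeparableSpace E] [SeparableSpace G] :
    IsGδ {φ : E →ₗᵢ[ℝ] G | IsAtomicOver φ} := by
  have : {φ : E →ₗᵢ[ℝ] G | IsAtomicOver φ} = ⋂ (n : ℕ) (m : ℕ) (k : ℕ), {φ | ∃ a' : Fin n → G,
      (∀ j, ‖denseSeq (Fin n → G) m j - a' j‖ ≤ 1 / ((k : ℝ) + 1)) ∧
      typeOf φ a' ∈ smallOpens E n (1 / ((k : ℝ) + 1))} := by
    ext φ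
    simp only [Set.mem_iInter]
    constructor
    · intro h n m k
      exact ⟨denseSeq (Fin n → G) m, fun j => by rw [sub_self, norm_zero]; positivity,
        (h n _).mem_smallOpens (by positivity)⟩
    · intro h n a
      refine isIsolated_typeOf_of_approx φ a fun r hr => ?_
      obtain ⟨k, hk⟩ := exists_nat_one_div_lt (half_pos hr)
      obtain ⟨m, hm⟩ := (denseRange_denseSeq (Fin n → G)).exists_dist_lt a (half_pos hr)
      obtain ⟨a', ha', V, ⟨hVo, hV⟩, haV⟩ := h n m k
      refine ⟨a', fun j => ?_, V, ⟨hVo, fun ζ hζ χ hχ => (hV ζ hζ χ hχ).mono (by linarith)⟩, haV⟩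
      have h1 := (dist_le_pi_dist a (denseSeq (Fin n → G) m) j).trans_lt hm
      have h2 := norm_sub_le_norm_sub_add_norm_sub (a j) (denseSeq (Fin n → G) m j) (a' j)
      rw [dist_eq_norm] at h1
      linarith [ha' j]
  rw [this]
  refine .iInter fun n => .iInter fun m => .iInter fun k => IsOpen.isGδ ?_
  simp only [Set.ofPred_exists, Set.ofPred_and]
  exact isOpen_iUnion fun a' =>
    isOpen_const.inter ((isOpen_smallOpens n _).preimage (continuous_typeOf a'))

/-- A non-isolated type is omitted by the generic embedding in a separable Gurarij space. -/
theorem IsGurarij.isMeagre_setOf_realises [SeparableSpace E] [SeparableSpace G] (hG : IsGurarij G)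
    {ξ : BanachType E n} (hξ : ¬ ξ.IsIsolated) :
    IsMeagre {ψ : E →ₗᵢ[ℝ] G | ∃ a, typeOf ψ a = ξ} := by
  classical
  rw [BanachType.isIsolated_iff] at hξ
  push Not at hξ
  obtain ⟨s, hs, hξ⟩ := hξ
  have hs4 : 0 < s / 4 := by positivity
  let Z : ℕ → Set (E →ₗᵢ[ℝ] G) := fun m =>
    {ψ | ∃ a, typeOf ψ a = ξ ∧ ∀ k, ‖a k - denseSeq (Fin n → G) m k‖ ≤ s / 4}
  refine (isMeagre_iUnion (f := Z) fun m => IsNowhereDense.isMeagre ?_).mono ?_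
  -- If the closure of `Z m` had interior, ξ would be isolated. On that closure the type of the
  -- fixed tuple b is s/4-close to ξ. Any ζ near ξ is realised by a tuple c over an embedding close
  -- to ψ₀, hence in the closure, with c within s/2 of b.
  · by_contra hne
    obtain ⟨ψ₁, hψ₁⟩ := Set.nonempty_iff_ne_empty.2 hne
    obtain ⟨ψ₀, hψ₀, a, rfl, ha⟩ := mem_closure_iff.1 (interior_subset hψ₁) _ isOpen_interior hψ₁
    obtain ⟨T, ε, hε, hT⟩ := LinearIsometry.mem_nhds_iff.1 (isOpen_interior.mem_nhds hψ₀)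
    refine hξ ?_
    set b := denseSeq (Fin n → G) m
    have hclosed : IsClosed
        {ψ : E →ₗᵢ[ℝ] G | BanachType.Close (s / 4) (typeOf ψ₀ a) (typeOf ψ b)} := by
      simp only [BanachType.Close, Set.ofPred_forall]
      refine isClosed_iInter fun e => isClosed_iInter fun t => isClosed_le ?_ continuous_const
      have : Continuous fun ψ : E →ₗᵢ[ℝ] G => (typeOf ψ b).toSeminorm (e, t) :=
        (BanachType.continuous_toSeminorm (e, t)).comp (continuous_typeOf b)
      fun_prop
    have hZ : closure (Z m) ⊆
        {ψ : E →ₗᵢ[ℝ] G | BanachType.Close (s / 4) (typeOf ψ₀ a) (typeOf ψ b)} := by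
      refine closure_minimal ?_ hclosed
      rintro ψ ⟨a'', ha'', hb⟩
      rw [Set.mem_ofPred_eq, ← ha'']
      exact (typeOf_isRealisedBy _ _).close (typeOf_isRealisedBy _ _) hb
    have hε' : 0 < min ε (s / 4) / 2 := by positivity
    filter_upwards [eventually_exists_realisation_amalgam ψ₀ a T hε'] with ζ hζ
    obtain ⟨F, _, _, i, c, N, _, hreal, h1, h2, h3, h4⟩ := hζ
    let z₁ : PUnit.{1} →ₗᵢ[ℝ] F := ⟨0, fun x => by simp⟩
    let z₂ : PUnit.{1} →ₗᵢ[ℝ] G := ⟨0, fun x => by simp⟩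
    have hN : IsAmalgam z₁ z₂ N := ⟨h1, h2, fun e => by
      rw [Subsingleton.elim e 0, map_zero, map_zero, neg_zero]
      exact map_zero N⟩
    -- Embedding F over the trivial space needs no atomicity over E; the copy of E then moves only
    -- slightly away from ψ₀, which keeps it inside the open set.
    obtain ⟨χ, -, hχ⟩ := hN.exists_linearIsometry_near (.of_subsingleton z₁) hG
      ((T.image fun e => (i e, -ψ₀ e)) ∪ Finset.univ.image fun k => (c k, -a k)) hε'
    have hU : χ.comp i ∈ closure (Z m) := interior_subset <| hT _ fun x hx => by
      have h5 := (abs_lt.1 (hχ (i x, -ψ₀ x)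
        (Finset.mem_union_left _ (Finset.mem_image_of_mem _ hx)))).2
      simp only [← sub_eq_add_neg] at h5
      change ‖χ (i x) - ψ₀ x‖ < ε
      linarith [h3 x hx, min_le_left ε (s / 4)]
    have hc : ∀ k, ‖b k - χ (c k)‖ ≤ s / 2 := fun k => by
      have h5 := (abs_lt.1 (hχ (c k, -a k)
        (Finset.mem_union_right _ (Finset.mem_image_of_mem _ (Finset.mem_univ k))))).2
      simp only [← sub_eq_add_neg] at h5
      have h6 := norm_sub_le_norm_sub_add_norm_sub (b k) (a k) (χ (c k))
      rw [norm_sub_rev (b k) (a k), norm_sub_rev (a k) (χ (c k))] at h6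
      linarith [h4 k, ha k, min_le_right ε (s / 4)]
    have hcl : BanachType.Close (s / 2) (typeOf (χ.comp i) b) ζ := by
      rw [← hreal.typeOf_eq, ← typeOf_comp χ]
      exact (typeOf_isRealisedBy _ _).close (typeOf_isRealisedBy _ _) hc
    exact (BanachType.Close.trans (hZ hU) hcl).mono (by linarith)
  · rintro ψ ⟨a, ha⟩
    obtain ⟨m, hm⟩ := (denseRange_denseSeq (Fin n → G)).exists_dist_lt a hs4
    refine Set.mem_iUnion.2 ⟨m, a, ha, fun k => ?_⟩
    rw [← dist_eq_norm]
    exact (dist_le_pi_dist a _ k).trans hm.le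

/-- Automorphisms carry realisations to realisations, so every embedding in the orbit realises the
same non-isolated type. -/
theorem IsGurarij.isMeagre_orbit [SeparableSpace E] [SeparableSpace G] (hG : IsGurarij G)
    {φ : E →ₗᵢ[ℝ] G} (hφ : ¬ IsAtomicOver φ) :
    IsMeagre (MulAction.orbit (G ≃ₗᵢ[ℝ] G) φ) := by
  unfold IsAtomicOver at hφ
  push Not at hφ
  obtain ⟨n, a, ha⟩ := hφ
  refine (hG.isMeagre_setOf_realises ha).mono ?_
  rintro _ ⟨h, rfl⟩
  exact ⟨fun k => h (a k), typeOf_comp h.toLinearIsometry φ a⟩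

end ApproximateRealisation

theorem mainTheorem9
    {E : Type u} [NormedAddCommGroup E] [NormedSpace ℝ E] [CompleteSpace E]
    [TopologicalSpace.SeparableSpace E]
    {G : Type v} [NormedAddCommGroup G] [NormedSpace ℝ G]
    [TopologicalSpace.SeparableSpace G] (hG : IsGurarij G) :
    (PolishSpace (E →ₗᵢ[ℝ] G) ∧
      ContinuousSMul (G ≃ₗᵢ[ℝ] G) (E →ₗᵢ[ℝ] G) ∧
      ∀ φ : E →ₗᵢ[ℝ] G, Dense (MulAction.orbit (G ≃ₗᵢ[ℝ] G) φ)) ∧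
    (ExistsAtomicGurarij E →
      Dense {φ : E →ₗᵢ[ℝ] G | IsAtomicOver φ} ∧
      IsGδ {φ : E →ₗᵢ[ℝ] G | IsAtomicOver φ} ∧
      ∃ φ₀ : E →ₗᵢ[ℝ] G,
        {φ : E →ₗᵢ[ℝ] G | IsAtomicOver φ} = MulAction.orbit (G ≃ₗᵢ[ℝ] G) φ₀) ∧
    (¬ ExistsAtomicGurarij E →
      (∀ φ : E →ₗᵢ[ℝ] G, ¬ IsAtomicOver φ) ∧
      ∀ φ : E →ₗᵢ[ℝ] G, IsMeagre (MulAction.orbit (G ≃ₗᵢ[ℝ] G) φ)) := by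
  have := hG.complete
  refine ⟨⟨polishSpace_linearIsometry, continuousSMul_linearIsometry, hG.dense_orbit⟩, ?_,
    fun hE => ?_⟩
  · rintro ⟨F, _, _, i, _, hF, hi⟩
    -- Uniqueness of the separable Gurarij space moves the given atomic extension onto G; density
    -- then comes for free, as the atomic embeddings form an orbit.
    obtain ⟨h⟩ := hF.nonempty_linearIsometryEquiv hG
    have heq := hG.orbit_eq_of_isAtomicOver (hi.comp_equiv h)
    exact ⟨heq ▸ hG.dense_orbit _, isGδ_setOf_isAtomicOver, _, heq⟩
  · have hna : ∀ φ : E →ₗᵢ[ℝ] G, ¬ IsAtomicOver φ :=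
      fun φ hφ => hE (existsAtomicGurarij_of_isAtomicOver hG hφ)
    exact ⟨hna, fun φ => hG.isMeagre_orbit (hna φ)⟩
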